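/- Let $\mathfrak F^{triv}$ be the trivial Feynman category, i.e. the symmetric monoidal category whose objects are the strings $\ast^{n}$, $n\in\mathbb N$, and whose morphisms are the permutations of letters. For a symmetric monoidal category $\mathcal M$, let $\mathcal M^{nc+}$ be the symmetric monoidal category (with product $\boxtimes$ and unit $\varnothing$) generated by the morphisms $\phi$ of $\mathcal M$ as objects and by the morphisms * $(\sigma\Downarrow\sigma'):\phi\to\sigma'\circ\phi\circ\sigma^{-1}$ for isomorphisms $\sigma,\sigma'$ of $\mathcal M$, * $\gamma:\phi_1\boxtimes\phi_0\to\phi_1\circ\phi_0$ for composable $\phi_1,\phi_0$, * $\mu:\phi\boxtimes\psi\to\phi\otimes\psi$, and $\varepsilon:\varnothing\to \mathrm{id}_{\mathbb 1}$ (the nullary case of $\mu$), subject to: functoriality of $(\sigma\Downarrow\sigma')$; associativity of $\gamma$ and its equivariance under isomorphisms; associativity, unitality (with unit $\varepsilon$) and equivariance of $\mu$, and its compatibility with the commutativity constraints; and the interchange law between $\gamma$ and $\mu$ (resp. $\varepsilon$). Let $\mathcal M^{+}$ be obtained from $\mathcal M^{nc+}$ by inverting all $\mu$ and $\varepsilon$,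 with quotient functor $q:\mathcal M^{nc+}\to\mathcal M^{+}$. An $\mathcal M^{nc+}$-op (resp. $\mathcal M^{+}$-op) in $\mathcal C$ is a strong symmetric monoidal functor to $\mathcal C$. Let $\mathcal C$ be a symmetric monoidal category and $M$ an object of $\mathcal C$ with an associative multiplication $m:M\otimes M\to M$ (a monoid, not necessarily unital). Let $A_n=M^{\otimes n}$, on which permutations act by the commutativity constraints; let $\mu_{p,q}:A_p\otimes A_q\to A_{p+q}$ be concatenation, let $\eta=\mathrm{id}:\mathbb 1\to A_0=\mathbb 1$, and let $\gamma_n$ be the composite $$A_n\otimes A_n\xrightarrow{\;c\;}(M\otimes M)^{\otimes n}\xrightarrow{\;m^{\otimes n}\;}A_n ,$$ where $c$ is the commutativity constraint of the shuffle that moves the $i$-th factor to position $2i-1$ and the $(n+i)$-th factor to position $2i$, for $1\le i\le n$. Then: 1. $(M,m)$ is an $(\mathfrak F^{triv})^{+}$-op: there are an $(\mathfrak F^{triv})^{+}$-op $P$ in $\mathcal C$ and an isomorphism $e:P(\mathrm{id}_\ast)\cong M$ that carries the multiplication of $P(\mathrm{id}_\ast)$ induced by $\gamma:\mathrm{id}_\ast\boxtimes\mathrm{id}_\ast\to\mathrm{id}_\ast$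 to $m$. 2. For every such $P$ and $e$, the pullback $P\circ q$ is an $(\mathfrak F^{triv})^{nc+}$-op for which there are isomorphisms $\theta_n:(P\circ q)(\mathrm{id}_{\ast^{n}})\cong A_n$, with $\theta_1=e$ (under $A_1\cong M$), carrying the images of $(\sigma\Downarrow\sigma)$, $\gamma$, $\mu$ and $\varepsilon$ to the permutation action, $\gamma_n$, $\mu_{p,q}$ and $\eta$ respectively. 3. $(A,\gamma,\mu,\eta)$ is a monoid object in the category of symmetric sequences of (not necessarily unital) monoids in $\mathcal C$: the permutation action is functorial and respects the associative multiplications $\gamma_n$; $\mu$ is equivariant, associative and unital with unit $\eta$; and $\mu_{p,q}$ and $\eta$ are morphisms of monoids. 4. If moreover $m$ has a two-sided unit $u:\mathbb 1\to M$, then each $A_n$ is a unital monoid with unit $u^{\otimes n}$, and the permutation action, $\mu_{p,q}$ and $\eta$ are morphisms of unital monoids. -/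

import Mathlib

open CategoryTheory MonoidalCategory

universe v u w

/-! ## Symmetric monoidal categories presented by generators and relations -/

/-- Formal tensor words in the letters `X`. -/
inductive Word (X : Type u) : Type u
  | of : X → Word X
  | unit : Word X
  | tensor : Word X → Word X → Word X

/-- Formal morphisms between tensor words, built from the generators `G` and the structure
morphisms of a symmetric monoidal category. -/
inductive PreHom {X : Type u} (G : Word X → Word X → Type w) : Word X → Word X → Type (max u w)
  | gen {a b : Word X} (g : G a b) : PreHom G a b
  | id (a : Word X) : PreHom G a a
  | comp {a b c : Word X} (f : PreHom G a b) (g : PreHom G b c) : PreHom G a c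
  | tensor {a b c d : Word X} (f : PreHom G a b) (g : PreHom G c d) :
      PreHom G (a.tensor c) (b.tensor d)
  | assoc (a b c : Word X) : PreHom G ((a.tensor b).tensor c) (a.tensor (b.tensor c))
  | assocInv (a b c : Word X) : PreHom G (a.tensor (b.tensor c)) ((a.tensor b).tensor c)
  | lunit (a : Word X) : PreHom G (Word.unit.tensor a) a
  | lunitInv (a : Word X) : PreHom G a (Word.unit.tensor a)
  | runit (a : Word X) : PreHom G (a.tensor Word.unit) a
  | runitInv (a : Word X) : PreHom G a (a.tensor Word.unit)
  | braid (a b : Word X) : PreHom G (a.tensor b) (b.tensor a)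

namespace PreHom

/-- The exchange of the two middle factors of a fourfold tensor word. -/
def exchange {X : Type u} {G : Word X → Word X → Type w} (a b c d : Word X) :
    PreHom G ((a.tensor b).tensor (c.tensor d)) ((a.tensor c).tensor (b.tensor d)) :=
  (assoc a b (c.tensor d)).comp
    (((PreHom.id a).tensor
      ((assocInv b c d).comp (((braid b c).tensor (PreHom.id d)).comp (assoc c b d)))).comp
        (assocInv a c (b.tensor d)))

/-- Renaming of generators. -/
def map {X : Type u} {G G' : Word X → Word X → Type w} (t : ∀ {a b : Word X}, G a b → G' a b) :
    ∀ {a b : Word X}, PreHom G a b → PreHom G' a b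
  | _, _, gen g => gen (t g)
  | _, _, id a => id a
  | _, _, comp f g => comp (map t f) (map t g)
  | _, _, tensor f g => tensor (map t f) (map t g)
  | _, _, assoc a b c => assoc a b c
  | _, _, assocInv a b c => assocInv a b c
  | _, _, lunit a => lunit a
  | _, _, lunitInv a => lunitInv a
  | _, _, runit a => runit a
  | _, _, runitInv a => runitInv a
  | _, _, braid a b => braid a b

end PreHom

/-- The congruence on formal morphisms generated by a family of relations `R` and by the axioms of
a symmetric monoidal category. -/
inductive WordRel {X : Type u} {G : Word X → Word X → Type w}
    (R : ∀ {a b : Word X}, PreHom G a b → PreHom G a b → Prop) :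
    ∀ {a b : Word X}, PreHom G a b → PreHom G a b → Prop
  | rel {a b : Word X} {f g : PreHom G a b} : R f g → WordRel R f g
  | refl {a b : Word X} (f : PreHom G a b) : WordRel R f f
  | symm {a b : Word X} {f g : PreHom G a b} : WordRel R f g → WordRel R g f
  | trans {a b : Word X} {f g h : PreHom G a b} : WordRel R f g → WordRel R g h → WordRel R f h
  | comp {a b c : Word X} {f f' : PreHom G a b} {g g' : PreHom G b c} :
      WordRel R f f' → WordRel R g g' → WordRel R (f.comp g) (f'.comp g')
  | tensor {a b c d : Word X} {f f' : PreHom G a b} {g g' : PreHom G c d} :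
      WordRel R f f' → WordRel R g g' → WordRel R (f.tensor g) (f'.tensor g')
  | id_comp {a b : Word X} (f : PreHom G a b) : WordRel R ((PreHom.id a).comp f) f
  | comp_id {a b : Word X} (f : PreHom G a b) : WordRel R (f.comp (PreHom.id b)) f
  | comp_assoc {a b c d : Word X} (f : PreHom G a b) (g : PreHom G b c) (h : PreHom G c d) :
      WordRel R ((f.comp g).comp h) (f.comp (g.comp h))
  | tensor_id (a b : Word X) :
      WordRel R ((PreHom.id a).tensor (PreHom.id b)) (PreHom.id (a.tensor b))
  | tensor_comp {a₁ b₁ c₁ a₂ b₂ c₂ : Word X} (f₁ : PreHom G a₁ b₁) (f₂ : PreHom G a₂ b₂)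
      (g₁ : PreHom G b₁ c₁) (g₂ : PreHom G b₂ c₂) :
      WordRel R ((f₁.tensor f₂).comp (g₁.tensor g₂)) ((f₁.comp g₁).tensor (f₂.comp g₂))
  | assoc_inv (a b c : Word X) :
      WordRel R ((PreHom.assoc a b c).comp (PreHom.assocInv a b c)) (PreHom.id _)
  | inv_assoc (a b c : Word X) :
      WordRel R ((PreHom.assocInv a b c).comp (PreHom.assoc a b c)) (PreHom.id _)
  | assoc_nat {a₁ a₂ a₃ b₁ b₂ b₃ : Word X} (f₁ : PreHom G a₁ b₁) (f₂ : PreHom G a₂ b₂)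
      (f₃ : PreHom G a₃ b₃) :
      WordRel R (((f₁.tensor f₂).tensor f₃).comp (PreHom.assoc b₁ b₂ b₃))
        ((PreHom.assoc a₁ a₂ a₃).comp (f₁.tensor (f₂.tensor f₃)))
  | lunit_inv (a : Word X) :
      WordRel R ((PreHom.lunit a).comp (PreHom.lunitInv a)) (PreHom.id _)
  | inv_lunit (a : Word X) :
      WordRel R ((PreHom.lunitInv a).comp (PreHom.lunit a)) (PreHom.id _)
  | lunit_nat {a b : Word X} (f : PreHom G a b) :
      WordRel R (((PreHom.id Word.unit).tensor f).comp (PreHom.lunit b))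
        ((PreHom.lunit a).comp f)
  | runit_inv (a : Word X) :
      WordRel R ((PreHom.runit a).comp (PreHom.runitInv a)) (PreHom.id _)
  | inv_runit (a : Word X) :
      WordRel R ((PreHom.runitInv a).comp (PreHom.runit a)) (PreHom.id _)
  | runit_nat {a b : Word X} (f : PreHom G a b) :
      WordRel R ((f.tensor (PreHom.id Word.unit)).comp (PreHom.runit b))
        ((PreHom.runit a).comp f)
  | pentagon (a b c d : Word X) :
      WordRel R
        (((PreHom.assoc a b c).tensor (PreHom.id d)).comp
          ((PreHom.assoc a (b.tensor c) d).comp ((PreHom.id a).tensor (PreHom.assoc b c d))))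
        ((PreHom.assoc (a.tensor b) c d).comp (PreHom.assoc a b (c.tensor d)))
  | triangle (a b : Word X) :
      WordRel R
        ((PreHom.assoc a Word.unit b).comp ((PreHom.id a).tensor (PreHom.lunit b)))
        ((PreHom.runit a).tensor (PreHom.id b))
  | braid_nat {a b c d : Word X} (f : PreHom G a b) (g : PreHom G c d) :
      WordRel R ((f.tensor g).comp (PreHom.braid b d)) ((PreHom.braid a c).comp (g.tensor f))
  | braid_braid (a b : Word X) :
      WordRel R ((PreHom.braid a b).comp (PreHom.braid b a)) (PreHom.id _)
  | hexagon (a b c : Word X) :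
      WordRel R
        ((PreHom.assoc a b c).comp
          ((PreHom.braid a (b.tensor c)).comp (PreHom.assoc b c a)))
        (((PreHom.braid a b).tensor (PreHom.id c)).comp
          ((PreHom.assoc b a c).comp ((PreHom.id b).tensor (PreHom.braid a c))))
  | hexagon_inv (a b c : Word X) :
      WordRel R
        ((PreHom.assocInv a b c).comp
          ((PreHom.braid (a.tensor b) c).comp (PreHom.assocInv c a b)))
        (((PreHom.id a).tensor (PreHom.braid b c)).comp
          ((PreHom.assocInv a c b).comp ((PreHom.braid a c).tensor (PreHom.id b))))

/-- The symmetric monoidal category with generating objects `X`, generating morphisms `G` and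
relations `R`. -/
def Presented {X : Type u} {G : Word X → Word X → Type w}
    (_R : ∀ {a b : Word X}, PreHom G a b → PreHom G a b → Prop) : Type u :=
  Word X

namespace Presented

variable {X : Type u} {G : Word X → Word X → Type w}
  {R : ∀ {a b : Word X}, PreHom G a b → PreHom G a b → Prop}

instance : Category (Presented R) where
  Hom a b := Quot (WordRel R (a := a) (b := b))
  id a := Quot.mk _ (PreHom.id a)
  comp f g := Quot.map₂ PreHom.comp (fun _ _ _ h => .comp (.refl _) h)
    (fun _ _ _ h => .comp h (.refl _)) f g
  id_comp := by
    rintro a b ⟨f⟩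
    exact Quot.sound (.id_comp f)
  comp_id := by
    rintro a b ⟨f⟩
    exact Quot.sound (.comp_id f)
  assoc := by
    rintro a b c d ⟨f⟩ ⟨g⟩ ⟨h⟩
    exact Quot.sound (.comp_assoc f g h)

/-- The morphism represented by a formal morphism. -/
def homMk {a b : Word X} (f : PreHom G a b) :
    (show Presented R from a) ⟶ (show Presented R from b) :=
  Quot.mk _ f

instance : MonoidalCategoryStruct (Presented R) where
  tensorObj a b := Word.tensor a b
  tensorUnit := Word.unit
  tensorHom f g := Quot.map₂ PreHom.tensor (fun _ _ _ h => .tensor (.refl _) h)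
    (fun _ _ _ h => .tensor h (.refl _)) f g
  whiskerLeft a _ _ f := Quot.map (fun f => (PreHom.id a).tensor f)
    (fun _ _ h => .tensor (.refl _) h) f
  whiskerRight f b := Quot.map (fun f => f.tensor (PreHom.id b))
    (fun _ _ h => .tensor h (.refl _)) f
  associator a b c := ⟨Quot.mk _ (.assoc a b c), Quot.mk _ (.assocInv a b c),
    Quot.sound (.assoc_inv a b c), Quot.sound (.inv_assoc a b c)⟩
  leftUnitor a := ⟨Quot.mk _ (.lunit a), Quot.mk _ (.lunitInv a),
    Quot.sound (.lunit_inv a), Quot.sound (.inv_lunit a)⟩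
  rightUnitor a := ⟨Quot.mk _ (.runit a), Quot.mk _ (.runitInv a),
    Quot.sound (.runit_inv a), Quot.sound (.inv_runit a)⟩

instance : MonoidalCategory (Presented R) :=
  MonoidalCategory.ofTensorHom
    (id_tensorHom_id := fun a b => Quot.sound (.tensor_id a b))
    (id_tensorHom := by
      rintro a b c ⟨f⟩
      rfl)
    (tensorHom_id := by
      rintro a b ⟨f⟩ c
      rfl)
    (tensorHom_comp_tensorHom := by
      rintro _ _ _ _ _ _ ⟨f₁⟩ ⟨f₂⟩ ⟨g₁⟩ ⟨g₂⟩
      exact Quot.sound (.tensor_comp f₁ f₂ g₁ g₂))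
    (associator_naturality := by
      rintro _ _ _ _ _ _ ⟨f₁⟩ ⟨f₂⟩ ⟨f₃⟩
      exact Quot.sound (.assoc_nat f₁ f₂ f₃))
    (leftUnitor_naturality := by
      rintro _ _ ⟨f⟩
      exact Quot.sound (.lunit_nat f))
    (rightUnitor_naturality := by
      rintro _ _ ⟨f⟩
      exact Quot.sound (.runit_nat f))
    (pentagon := fun a b c d => Quot.sound (.pentagon a b c d))
    (triangle := fun a b => Quot.sound (.triangle a b))

instance : SymmetricCategory (Presented R) where
  braiding a b := ⟨Quot.mk _ (.braid a b), Quot.mk _ (.braid b a),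
    Quot.sound (.braid_braid a b), Quot.sound (.braid_braid b a)⟩
  braiding_naturality_right := by
    rintro a _ _ ⟨f⟩
    exact Quot.sound (.braid_nat (.id a) f)
  braiding_naturality_left := by
    rintro _ _ ⟨f⟩ a
    exact Quot.sound (.braid_nat f (.id a))
  hexagon_forward a b c := Quot.sound (.hexagon a b c)
  hexagon_reverse a b c := Quot.sound (.hexagon_inv a b c)
  symmetry a b := Quot.sound (.braid_braid a b)

end Presented

/-! ## The nc-plus construction and the plus construction

Both are formed over a symmetric monoidal category `M`.  The letters of a word are morphisms of
`M`, and the tensor product of words is written `⊠`. -/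

section Plus

variable (M : Type u) [Category.{v} M] [MonoidalCategory M]

/-- A morphism of `M` seen as a one-letter word. -/
abbrev letter {M : Type u} [Category.{v} M] {a b : M} (φ : a ⟶ b) : Word (Arrow M) :=
  Word.of (Arrow.mk φ)

/-- Generators of the nc-plus construction: `iso σ σ'` is `(σ ⇓ σ') : φ ⟶ σ' ∘ φ ∘ σ⁻¹`,
`γ φ₁ φ₀ : φ₁ ⊠ φ₀ ⟶ φ₁ ∘ φ₀`, `μ φ ψ : φ ⊠ ψ ⟶ φ ⊗ ψ`, and `ε : ∅ ⟶ id_𝟙` is the nullary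
instance of `μ`. -/
inductive NCGen : Word (Arrow M) → Word (Arrow M) → Type (max u v)
  | iso {a b a' b' : M} {φ : a ⟶ b} {ψ : a' ⟶ b'} (σ : a ≅ a') (σ' : b ≅ b')
      (h : φ ≫ σ'.hom = σ.hom ≫ ψ) : NCGen (letter φ) (letter ψ)
  | γ {a b c : M} (φ₁ : b ⟶ c) (φ₀ : a ⟶ b) :
      NCGen ((letter φ₁).tensor (letter φ₀)) (letter (φ₀ ≫ φ₁))
  | μ {a b c d : M} (φ : a ⟶ b) (ψ : c ⟶ d) :
      NCGen ((letter φ).tensor (letter ψ)) (letter (φ ⊗ₘ ψ))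
  | ε : NCGen Word.unit (letter (𝟙 (𝟙_ M)))

namespace NCGen

variable {M}

/-- The formal morphism `(σ ⇓ σ')`. -/
def isoP {a b a' b' : M} {φ : a ⟶ b} {ψ : a' ⟶ b'} (σ : a ≅ a') (σ' : b ≅ b')
    (h : φ ≫ σ'.hom = σ.hom ≫ ψ) : PreHom (NCGen M) (letter φ) (letter ψ) :=
  .gen (.iso σ σ' h)

/-- The formal morphism `(id ⇓ id)` between two expressions of the same morphism. -/
def eqP {a b : M} {φ ψ : a ⟶ b} (h : φ = ψ) : PreHom (NCGen M) (letter φ) (letter ψ) :=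
  isoP (Iso.refl a) (Iso.refl b) (by simp [h])

/-- The formal morphism `γ`. -/
def γP {a b c : M} (φ₁ : b ⟶ c) (φ₀ : a ⟶ b) :
    PreHom (NCGen M) ((letter φ₁).tensor (letter φ₀)) (letter (φ₀ ≫ φ₁)) :=
  .gen (.γ φ₁ φ₀)

/-- The formal morphism `μ`. -/
def μP {a b c d : M} (φ : a ⟶ b) (ψ : c ⟶ d) :
    PreHom (NCGen M) ((letter φ).tensor (letter ψ)) (letter (φ ⊗ₘ ψ)) :=
  .gen (.μ φ ψ)

/-- The formal morphism `ε`. -/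
def εP : PreHom (NCGen M) Word.unit (letter (𝟙 (𝟙_ M))) :=
  .gen .ε

end NCGen

open NCGen in
/-- Relations of the nc-plus construction. -/
inductive NCRel [SymmetricCategory M] :
    ∀ {a b : Word (Arrow M)}, PreHom (NCGen M) a b → PreHom (NCGen M) a b → Prop
  /- `(id ⇓ id) = id` -/
  | iso_id {a b : M} (φ : a ⟶ b) :
      NCRel (isoP (φ := φ) (ψ := φ) (Iso.refl a) (Iso.refl b) (by simp)) (PreHom.id _)
  /- `(τ ⇓ τ') ∘ (σ ⇓ σ') = (τ ∘ σ ⇓ τ' ∘ σ')` -/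
  | iso_comp {a b a' b' a'' b'' : M} {φ : a ⟶ b} {φ' : a' ⟶ b'} {φ'' : a'' ⟶ b''}
      (σ : a ≅ a') (σ' : b ≅ b') (h : φ ≫ σ'.hom = σ.hom ≫ φ')
      (τ : a' ≅ a'') (τ' : b' ≅ b'') (k : φ' ≫ τ'.hom = τ.hom ≫ φ'') :
      NCRel ((isoP σ σ' h).comp (isoP τ τ' k))
        (isoP (σ ≪≫ τ) (σ' ≪≫ τ') (by simp [← k, reassoc_of% h]))
  /- associativity of `γ` -/
  | γ_assoc {a b c d : M} (φ₂ : c ⟶ d) (φ₁ : b ⟶ c) (φ₀ : a ⟶ b) :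
      NCRel (((γP φ₂ φ₁).tensor (PreHom.id _)).comp (γP (φ₁ ≫ φ₂) φ₀))
        ((PreHom.assoc _ _ _).comp (((PreHom.id _).tensor (γP φ₁ φ₀)).comp
          ((γP φ₂ (φ₀ ≫ φ₁)).comp (eqP (Category.assoc φ₀ φ₁ φ₂)))))
  /- inner and outer equivariance of `γ` -/
  | γ_equiv {a b c a' b' c' : M} {φ₁ : b ⟶ c} {φ₀ : a ⟶ b} {φ₁' : b' ⟶ c'} {φ₀' : a' ⟶ b'}
      (σ : a ≅ a') (τ : b ≅ b') (ρ : c ≅ c')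
      (h₀ : φ₀ ≫ τ.hom = σ.hom ≫ φ₀') (h₁ : φ₁ ≫ ρ.hom = τ.hom ≫ φ₁') :
      NCRel (((isoP τ ρ h₁).tensor (isoP σ τ h₀)).comp (γP φ₁' φ₀'))
        ((γP φ₁ φ₀).comp (isoP σ ρ (by simp [h₁, reassoc_of% h₀])))
  /- associativity of `μ` -/
  | μ_assoc {a b c d e f : M} (φ : a ⟶ b) (ψ : c ⟶ d) (χ : e ⟶ f) :
      NCRel (((μP φ ψ).tensor (PreHom.id _)).comp ((μP (φ ⊗ₘ ψ) χ).comp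
          (isoP (ψ := φ ⊗ₘ (ψ ⊗ₘ χ)) (α_ a c e) (α_ b d f) (by simp))))
        ((PreHom.assoc _ _ _).comp (((PreHom.id _).tensor (μP ψ χ)).comp (μP φ (ψ ⊗ₘ χ))))
  /- left unitality of `μ` -/
  | μ_left_unit {a b : M} (φ : a ⟶ b) :
      NCRel ((εP.tensor (PreHom.id _)).comp ((μP (𝟙 (𝟙_ M)) φ).comp
          (isoP (ψ := φ) (λ_ a) (λ_ b) (by simp))))
        (PreHom.lunit _)
  /- right unitality of `μ` -/
  | μ_right_unit {a b : M} (φ : a ⟶ b) :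
      NCRel (((PreHom.id _).tensor εP).comp ((μP φ (𝟙 (𝟙_ M))).comp
          (isoP (ψ := φ) (ρ_ a) (ρ_ b) (by simp))))
        (PreHom.runit _)
  /- compatibility of `μ` with the commutativity constraints -/
  | μ_comm {a b c d : M} (φ : a ⟶ b) (ψ : c ⟶ d) :
      NCRel ((μP φ ψ).comp (isoP (ψ := ψ ⊗ₘ φ) (β_ a c) (β_ b d) (by simp)))
        ((PreHom.braid _ _).comp (μP ψ φ))
  /- equivariance of `μ` -/
  | μ_equiv {a b a' b' c d c' d' : M} {φ : a ⟶ b} {φ' : a' ⟶ b'} {ψ : c ⟶ d} {ψ' : c' ⟶ d'}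
      (σ : a ≅ a') (σ' : b ≅ b') (h : φ ≫ σ'.hom = σ.hom ≫ φ')
      (τ : c ≅ c') (τ' : d ≅ d') (k : ψ ≫ τ'.hom = τ.hom ≫ ψ') :
      NCRel (((isoP σ σ' h).tensor (isoP τ τ' k)).comp (μP φ' ψ'))
        ((μP φ ψ).comp (isoP (σ ⊗ᵢ τ) (σ' ⊗ᵢ τ') (by simp [tensorHom_comp_tensorHom, h, k])))
  /- interchange of `γ` and `μ` -/
  | interchange {a b c a' b' c' : M} (φ₁ : b ⟶ c) (φ₀ : a ⟶ b) (ψ₁ : b' ⟶ c') (ψ₀ : a' ⟶ b') :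
      NCRel (((μP φ₁ ψ₁).tensor (μP φ₀ ψ₀)).comp ((γP (φ₁ ⊗ₘ ψ₁) (φ₀ ⊗ₘ ψ₀)).comp
          (eqP (tensorHom_comp_tensorHom φ₀ ψ₀ φ₁ ψ₁))))
        ((PreHom.exchange _ _ _ _).comp (((γP φ₁ φ₀).tensor (γP ψ₁ ψ₀)).comp
          (μP (φ₀ ≫ φ₁) (ψ₀ ≫ ψ₁))))
  /- nullary interchange -/
  | interchange_unit :
      NCRel ((εP.tensor εP).comp
          ((γP (𝟙 (𝟙_ M)) (𝟙 (𝟙_ M))).comp (eqP (Category.comp_id (𝟙 (𝟙_ M))))))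
        ((PreHom.lunit Word.unit).comp εP)

/-- Generators of the plus construction: those of the nc-plus construction, together with
inverses of `μ` and of its nullary instance `ε`. -/
inductive PlusGen : Word (Arrow M) → Word (Arrow M) → Type (max u v)
  | nc {a b : Word (Arrow M)} (g : NCGen M a b) : PlusGen a b
  | μInv {a b c d : M} (φ : a ⟶ b) (ψ : c ⟶ d) :
      PlusGen (letter (φ ⊗ₘ ψ)) ((letter φ).tensor (letter ψ))
  | εInv : PlusGen (letter (𝟙 (𝟙_ M))) Word.unit

/-- Relations of the plus construction. -/
inductive PlusRel [SymmetricCategory M] :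
    ∀ {a b : Word (Arrow M)}, PreHom (PlusGen M) a b → PreHom (PlusGen M) a b → Prop
  | nc {a b : Word (Arrow M)} {f g : PreHom (NCGen M) a b} (h : NCRel M f g) :
      PlusRel (f.map PlusGen.nc) (g.map PlusGen.nc)
  | μ_μInv {a b c d : M} (φ : a ⟶ b) (ψ : c ⟶ d) :
      PlusRel ((PreHom.gen (.nc (.μ φ ψ))).comp (PreHom.gen (.μInv φ ψ))) (PreHom.id _)
  | μInv_μ {a b c d : M} (φ : a ⟶ b) (ψ : c ⟶ d) :
      PlusRel ((PreHom.gen (.μInv φ ψ)).comp (PreHom.gen (.nc (.μ φ ψ)))) (PreHom.id _)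
  | ε_εInv : PlusRel ((PreHom.gen (.nc .ε)).comp (PreHom.gen .εInv)) (PreHom.id _)
  | εInv_ε : PlusRel ((PreHom.gen .εInv).comp (PreHom.gen (.nc .ε))) (PreHom.id _)

variable [SymmetricCategory M]

/-- The nc-plus construction `M^{nc+}`. -/
abbrev NCPlus : Type (max u v) := Presented (NCRel M)

/-- The (localized) plus construction `M^+`. -/
abbrev Plus : Type (max u v) := Presented (PlusRel M)

variable {M}

theorem wordRel_map_nc {a b : Word (Arrow M)} {f g : PreHom (NCGen M) a b}
    (h : WordRel (NCRel M) f g) :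
    WordRel (PlusRel M) (f.map PlusGen.nc) (g.map PlusGen.nc) := by
  induction h with
  | rel h => exact .rel (.nc h)
  | refl f => exact .refl _
  | symm _ ih => exact .symm ih
  | trans _ _ ih₁ ih₂ => exact .trans ih₁ ih₂
  | comp _ _ ih₁ ih₂ => exact .comp ih₁ ih₂
  | tensor _ _ ih₁ ih₂ => exact .tensor ih₁ ih₂
  | id_comp f => exact .id_comp _
  | comp_id f => exact .comp_id _
  | comp_assoc f g h => exact .comp_assoc _ _ _
  | tensor_id a b => exact .tensor_id _ _
  | tensor_comp f₁ f₂ g₁ g₂ => exact .tensor_comp _ _ _ _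
  | assoc_inv a b c => exact .assoc_inv _ _ _
  | inv_assoc a b c => exact .inv_assoc _ _ _
  | assoc_nat f₁ f₂ f₃ => exact .assoc_nat _ _ _
  | lunit_inv a => exact .lunit_inv _
  | inv_lunit a => exact .inv_lunit _
  | lunit_nat f => exact .lunit_nat _
  | runit_inv a => exact .runit_inv _
  | inv_runit a => exact .inv_runit _
  | runit_nat f => exact .runit_nat _
  | pentagon a b c d => exact .pentagon _ _ _ _
  | triangle a b => exact .triangle _ _
  | braid_nat f g => exact .braid_nat _ _
  | braid_braid a b => exact .braid_braid _ _
  | hexagon a b c => exact .hexagon _ _ _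
  | hexagon_inv a b c => exact .hexagon_inv _ _ _

variable (M)

/-- The quotient (localization) functor `M^{nc+} ⥤ M^+`: the identity on words and on
generators. -/
def plusQuotient : NCPlus M ⥤ Plus M where
  obj a := a
  map f := Quot.map (fun f => f.map PlusGen.nc) (fun _ _ h => wordRel_map_nc h) f
  map_id _ := rfl
  map_comp := by
    rintro _ _ _ ⟨f⟩ ⟨g⟩
    rfl

instance : (plusQuotient M).Monoidal :=
  Functor.CoreMonoidal.toMonoidal
    { εIso := Iso.refl _
      μIso := fun a b => Iso.refl (show Plus M from Word.tensor a b)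
      μIso_hom_natural_left := by
        rintro a b ⟨f⟩ c
        exact (Category.comp_id _).trans (Category.id_comp _).symm
      μIso_hom_natural_right := by
        rintro a b c ⟨f⟩
        exact (Category.comp_id _).trans (Category.id_comp _).symm
      associativity := by
        intro a b c
        have h : ∀ a b c : Plus M, 𝟙 (a ⊗ b) ▷ c ≫ 𝟙 ((a ⊗ b) ⊗ c) ≫ (α_ a b c).hom =
            (α_ a b c).hom ≫ a ◁ 𝟙 (b ⊗ c) ≫ 𝟙 (a ⊗ (b ⊗ c)) := by simp
        exact h a b c
      left_unitality := by
        intro a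
        have h : ∀ a : Plus M, (λ_ a).hom =
            𝟙 (𝟙_ (Plus M)) ▷ a ≫ 𝟙 (𝟙_ (Plus M) ⊗ a) ≫ (λ_ a).hom := by simp
        exact h a
      right_unitality := by
        intro a
        have h : ∀ a : Plus M, (ρ_ a).hom =
            a ◁ 𝟙 (𝟙_ (Plus M)) ≫ 𝟙 (a ⊗ 𝟙_ (Plus M)) ≫ (ρ_ a).hom := by simp
        exact h a }

instance : (plusQuotient M).Braided where
  braided a b :=
    have h : ∀ a b : Plus M, 𝟙 (a ⊗ b) ≫ (β_ a b).hom = (β_ a b).hom ≫ 𝟙 (b ⊗ a) := by simp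
    h a b

end Plus

/-! ## The trivial Feynman category -/

/-- The trivial Feynman category: the object of length `n` is the string `∗^{⊠ n}`, and the
morphisms are permutations (a permutation sends the letter in position `i` to position `σ i`). -/
structure FTriv : Type where
  /-- The length of the string. -/
  len : ℕ

namespace FTriv

instance : Category FTriv where
  Hom a b := Fin a.len ≃ Fin b.len
  id a := Equiv.refl (Fin a.len)
  comp f g := Equiv.trans f g

/-- Regard a bijection as an isomorphism of strings. -/
def ofEquiv {a b : FTriv} (σ : Fin a.len ≃ Fin b.len) : a ≅ b where
  hom := σ
  inv := σ.symm
  hom_inv_id := σ.self_trans_symm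
  inv_hom_id := σ.symm_trans_self

/-- Juxtaposition of bijections. -/
def sumMap {a b c d : ℕ} (σ : Fin a ≃ Fin b) (τ : Fin c ≃ Fin d) : Fin (a + c) ≃ Fin (b + d) :=
  finSumFinEquiv.symm.trans ((Equiv.sumCongr σ τ).trans finSumFinEquiv)

instance : MonoidalCategoryStruct FTriv where
  tensorObj a b := ⟨a.len + b.len⟩
  tensorUnit := ⟨0⟩
  tensorHom f g := sumMap f g
  whiskerLeft a _ _ g := sumMap (Equiv.refl (Fin a.len)) g
  whiskerRight f b := sumMap f (Equiv.refl (Fin b.len))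
  associator a b c := ofEquiv (finCongr (Nat.add_assoc a.len b.len c.len))
  leftUnitor a := ofEquiv (finCongr (Nat.zero_add a.len))
  rightUnitor a := ofEquiv (finCongr (Nat.add_zero a.len))

theorem sumMap_refl (a b : ℕ) :
    sumMap (Equiv.refl (Fin a)) (Equiv.refl (Fin b)) = Equiv.refl (Fin (a + b)) := by
  simp [sumMap]

theorem sumMap_trans {a₁ b₁ c₁ a₂ b₂ c₂ : ℕ} (f₁ : Fin a₁ ≃ Fin b₁) (f₂ : Fin a₂ ≃ Fin b₂)
    (g₁ : Fin b₁ ≃ Fin c₁) (g₂ : Fin b₂ ≃ Fin c₂) :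
    (sumMap f₁ f₂).trans (sumMap g₁ g₂) = sumMap (f₁.trans g₁) (f₂.trans g₂) := by
  ext i
  refine Fin.addCases (fun j => ?_) (fun j => ?_) i <;> simp [sumMap]

@[simp]
theorem sumMap_castAdd {a b c d : ℕ} (f : Fin a ≃ Fin b) (g : Fin c ≃ Fin d) (i : Fin a) :
    sumMap f g (Fin.castAdd c i) = Fin.castAdd d (f i) := by
  simp [sumMap]

@[simp]
theorem sumMap_natAdd {a b c d : ℕ} (f : Fin a ≃ Fin b) (g : Fin c ≃ Fin d) (i : Fin c) :
    sumMap f g (Fin.natAdd a i) = Fin.natAdd b (g i) := by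
  simp [sumMap]

theorem sumMap_val {a b c d : ℕ} (f : Fin a ≃ Fin b) (g : Fin c ≃ Fin d) (i : Fin (a + c)) :
    (sumMap f g i : ℕ) =
      if h : (i : ℕ) < a then (f ⟨i, h⟩ : ℕ) else b + (g ⟨i - a, by omega⟩ : ℕ) := by
  refine Fin.addCases (fun j => ?_) (fun j => ?_) i <;> simp

theorem sumMap_assoc {a₁ a₂ a₃ b₁ b₂ b₃ : ℕ} (f₁ : Fin a₁ ≃ Fin b₁) (f₂ : Fin a₂ ≃ Fin b₂)
    (f₃ : Fin a₃ ≃ Fin b₃) :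
    (sumMap (sumMap f₁ f₂) f₃).trans (finCongr (Nat.add_assoc b₁ b₂ b₃)) =
      (finCongr (Nat.add_assoc a₁ a₂ a₃)).trans (sumMap f₁ (sumMap f₂ f₃)) := by
  ext i
  simp only [Equiv.trans_apply, finCongr_apply, Fin.val_cast, sumMap_val]
  split_ifs <;> first | omega | rfl | skip
  simp only [Nat.sub_sub]
  omega

theorem sumMap_zero_left {a b : ℕ} (f : Fin a ≃ Fin b) :
    (sumMap (Equiv.refl (Fin 0)) f).trans (finCongr (Nat.zero_add b)) =
      (finCongr (Nat.zero_add a)).trans f := by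
  ext i
  simp [sumMap_val]
  rfl

theorem sumMap_zero_right {a b : ℕ} (f : Fin a ≃ Fin b) :
    (sumMap f (Equiv.refl (Fin 0))).trans (finCongr (Nat.add_zero b)) =
      (finCongr (Nat.add_zero a)).trans f := by
  ext i
  exact congrArg Fin.val (sumMap_castAdd f (Equiv.refl (Fin 0)) i)

theorem sumMap_finCongr {a b c d : ℕ} (h : a = b) (k : c = d) :
    sumMap (finCongr h) (finCongr k) = finCongr (by rw [h, k]) := by
  subst h k
  exact sumMap_refl a c

theorem finAddFlip_val {a b : ℕ} (i : Fin (a + b)) :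
    (finAddFlip i : ℕ) = if (i : ℕ) < a then b + i else i - a := by
  refine Fin.addCases (fun j => ?_) (fun j => ?_) i <;> simp

theorem sumMap_finAddFlip {a b c d : ℕ} (f : Fin a ≃ Fin b) (g : Fin c ≃ Fin d) :
    (sumMap f g).trans finAddFlip = finAddFlip.trans (sumMap g f) := by
  ext i
  refine Fin.addCases (fun j => ?_) (fun j => ?_) i <;> simp

theorem finAddFlip_hexagon (a b c : ℕ) :
    (finCongr (Nat.add_assoc a b c)).trans
        ((finAddFlip (m := a) (n := b + c)).trans (finCongr (Nat.add_assoc b c a))) =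
      (sumMap (finAddFlip (m := a) (n := b)) (Equiv.refl (Fin c))).trans
        ((finCongr (Nat.add_assoc b a c)).trans
          (sumMap (Equiv.refl (Fin b)) (finAddFlip (m := a) (n := c)))) := by
  ext i
  simp only [Equiv.trans_apply, finCongr_apply, Fin.val_cast, sumMap_val, finAddFlip_val,
    Equiv.refl_apply]
  split_ifs <;> omega

theorem finAddFlip_hexagon_inv (a b c : ℕ) :
    (finCongr (Nat.add_assoc a b c)).symm.trans
        ((finAddFlip (m := a + b) (n := c)).trans (finCongr (Nat.add_assoc c a b)).symm) =
      (sumMap (Equiv.refl (Fin a)) (finAddFlip (m := b) (n := c))).trans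
        ((finCongr (Nat.add_assoc a c b)).symm.trans
          (sumMap (finAddFlip (m := a) (n := c)) (Equiv.refl (Fin b)))) := by
  ext i
  simp only [Equiv.trans_apply, finCongr_symm, finCongr_apply, Fin.val_cast, sumMap_val,
    finAddFlip_val, Equiv.refl_apply]
  split_ifs <;> omega

instance : MonoidalCategory FTriv :=
  MonoidalCategory.ofTensorHom
    (id_tensorHom_id := fun a b => sumMap_refl a.len b.len)
    (id_tensorHom := fun _ _ _ _ => rfl)
    (tensorHom_id := fun _ _ => rfl)
    (tensorHom_comp_tensorHom := fun f₁ f₂ g₁ g₂ => sumMap_trans f₁ f₂ g₁ g₂)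
    (associator_naturality := fun f₁ f₂ f₃ => sumMap_assoc f₁ f₂ f₃)
    (leftUnitor_naturality := fun f => sumMap_zero_left f)
    (rightUnitor_naturality := fun f => sumMap_zero_right f)
    (pentagon := fun a b c d => by
      have h : (sumMap (finCongr (Nat.add_assoc a.len b.len c.len)) (finCongr (rfl : d.len = _))).trans
          ((finCongr (Nat.add_assoc a.len (b.len + c.len) d.len)).trans
            (sumMap (finCongr (rfl : a.len = _)) (finCongr (Nat.add_assoc b.len c.len d.len)))) =
          (finCongr (Nat.add_assoc (a.len + b.len) c.len d.len)).trans
            (finCongr (Nat.add_assoc a.len b.len (c.len + d.len))) := by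
        rw [sumMap_finCongr, sumMap_finCongr]
        rfl
      exact h)
    (triangle := fun a b => by
      have h : (finCongr (Nat.add_assoc a.len 0 b.len)).trans
          (sumMap (finCongr (rfl : a.len = _)) (finCongr (Nat.zero_add b.len))) =
          sumMap (finCongr (Nat.add_zero a.len)) (finCongr (rfl : b.len = _)) := by
        rw [sumMap_finCongr, sumMap_finCongr]
        rfl
      exact h)

instance : SymmetricCategory FTriv where
  braiding a b := ofEquiv (finAddFlip (m := a.len) (n := b.len))
  braiding_naturality_right a _ _ f := sumMap_finAddFlip (Equiv.refl (Fin a.len)) f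
  braiding_naturality_left f c := sumMap_finAddFlip f (Equiv.refl (Fin c.len))
  hexagon_forward a b c := finAddFlip_hexagon a.len b.len c.len
  hexagon_reverse a b c := finAddFlip_hexagon_inv a.len b.len c.len
  symmetry a b := by
    have h : (finAddFlip (m := a.len) (n := b.len)).trans (finAddFlip (m := b.len) (n := a.len)) =
        Equiv.refl (Fin (a.len + b.len)) := by
      ext i
      simp only [Equiv.trans_apply, finAddFlip_val, Equiv.refl_apply]
      split_ifs <;> omega
    exact h

end FTriv

/-! ## Basic objects and morphisms over the trivial Feynman category -/

namespace FTriv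

/-- The basic object `id_{∗^n}` of `(F^triv)^{nc+}`. -/
def basic (n : FTriv) : NCPlus FTriv := letter (𝟙 n)

/-- The morphism `(σ ⇓ σ) : id_{∗^n} ⟶ id_{∗^m}` of `(F^triv)^{nc+}`. -/
def ncAct {n m : FTriv} (σ : Fin n.len ≃ Fin m.len) : basic n ⟶ basic m :=
  Presented.homMk (NCGen.isoP (φ := 𝟙 n) (ψ := 𝟙 m) (ofEquiv σ) (ofEquiv σ) (by simp))

/-- The morphism `γ : id_{∗^n} ⊠ id_{∗^n} ⟶ id_{∗^n}` of `(F^triv)^{nc+}`. -/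
def ncγ (n : FTriv) : basic n ⊗ basic n ⟶ basic n :=
  Presented.homMk ((NCGen.γP (𝟙 n) (𝟙 n)).comp (NCGen.eqP (Category.comp_id (𝟙 n))))

/-- The morphism `μ : id_{∗^p} ⊠ id_{∗^q} ⟶ id_{∗^{p+q}}` of `(F^triv)^{nc+}`. -/
def ncμ (p q : FTriv) : basic p ⊗ basic q ⟶ basic (p ⊗ q) :=
  Presented.homMk ((NCGen.μP (𝟙 p) (𝟙 q)).comp (NCGen.eqP (id_tensorHom_id p q)))

/-- The morphism `ε : ∅ ⟶ id_{∗^0}` of `(F^triv)^{nc+}`. -/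
def ncε : 𝟙_ (NCPlus FTriv) ⟶ basic (𝟙_ FTriv) :=
  Presented.homMk NCGen.εP

/-- The basic object `id_∗` of `(F^triv)^+`. -/
def star : Plus FTriv := (plusQuotient FTriv).obj (basic ⟨1⟩)

/-- The multiplication `γ : id_∗ ⊠ id_∗ ⟶ id_∗` of `(F^triv)^+`. -/
def starMul : star ⊗ star ⟶ star := (plusQuotient FTriv).map (ncγ ⟨1⟩)

end FTriv

/-! ## Tensor powers -/

section TensorPower

variable {C : Type u} [Category.{v} C] [MonoidalCategory C]

/-- The tensor power `M^{⊗ n}`. -/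
def tpow (M : C) : ℕ → C
  | 0 => 𝟙_ C
  | n + 1 => tpow M n ⊗ M

/-- Concatenation `M^{⊗ p} ⊗ M^{⊗ q} ⟶ M^{⊗ (p + q)}`. -/
def concat (M : C) (p : ℕ) : ∀ q : ℕ, tpow M p ⊗ tpow M q ⟶ tpow M (p + q)
  | 0 => (ρ_ (tpow M p)).hom
  | q + 1 => (α_ (tpow M p) (tpow M q) M).inv ≫ concat M p q ▷ M

/-- `m^{⊗ n} : (M ⊗ M)^{⊗ n} ⟶ M^{⊗ n}`, multiplying the factors in positions `2 i` and
`2 i + 1` (counted from `0`). -/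
def pairMul (M : C) (m : M ⊗ M ⟶ M) : ∀ n : ℕ, tpow M (2 * n) ⟶ tpow M n
  | 0 => 𝟙 (𝟙_ C)
  | n + 1 => (α_ (tpow M (2 * n)) M M).hom ≫ (pairMul M m n ⊗ₘ m)

/-- `u^{⊗ n} : 𝟙 ⟶ M^{⊗ n}`. -/
def unitPow (M : C) (u : 𝟙_ C ⟶ M) : ∀ n : ℕ, 𝟙_ C ⟶ tpow M n
  | 0 => 𝟙 (𝟙_ C)
  | n + 1 => (λ_ (𝟙_ C)).inv ≫ (unitPow M u n ⊗ₘ u)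

variable [SymmetricCategory C]

/-- The commutativity constraint `M^{⊗ n} ⊗ M ⟶ M^{⊗ (n + 1)}` that moves the last factor to
position `i` and keeps the order of the others. -/
def insertLast (M : C) : ∀ n : ℕ, Fin (n + 1) → (tpow M n ⊗ M ⟶ tpow M (n + 1))
  | 0, _ => 𝟙 (tpow M 1)
  | n + 1, i =>
    if h : i = Fin.last (n + 1) then 𝟙 (tpow M (n + 2))
    else (α_ (tpow M n) M M).hom ≫ tpow M n ◁ (β_ M M).hom ≫ (α_ (tpow M n) M M).inv ≫
      insertLast M n (i.castPred h) ▷ M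

/-- The bijection obtained from `σ` by deleting the last position and its image. -/
def dropLast {n m : ℕ} (σ : Fin (n + 1) ≃ Fin (m + 1)) : Fin n ≃ Fin m :=
  Equiv.removeNone
    ((finSuccEquiv' (Fin.last n)).symm.trans (σ.trans (finSuccEquiv' (σ (Fin.last n)))))

/-- The commutativity constraint associated to a permutation: the factor in position `i` is moved
to position `σ i`. -/
def permMap (M : C) : ∀ {n m : ℕ}, (Fin n ≃ Fin m) → (tpow M n ⟶ tpow M m)
  | 0, 0, _ => 𝟙 (𝟙_ C)
  | 0, _ + 1, σ => (σ.symm 0).elim0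
  | _ + 1, 0, σ => (σ 0).elim0
  | n + 1, m + 1, σ => permMap M (dropLast σ) ▷ M ≫ insertLast M m (σ (Fin.last n))

/-- The shuffle permutation, which (counted from `0`) sends position `i` to `2 i` and position
`n + i` to `2 i + 1`, for `i < n`. -/
def shuffle (n : ℕ) : Fin (n + n) ≃ Fin (2 * n) where
  toFun i := if _h : (i : ℕ) < n then ⟨2 * i, by omega⟩ else ⟨2 * (i - n) + 1, by omega⟩
  invFun j := if _h : (j : ℕ) % 2 = 0 then ⟨j / 2, by omega⟩ else ⟨n + j / 2, by omega⟩
  left_inv i := by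
    by_cases h : (i : ℕ) < n
    · simp [h]
    · have h' : ¬ (2 * ((i : ℕ) - n) + 1) % 2 = 0 := by omega
      ext
      simp only [h, h', dite_false]
      omega
  right_inv j := by
    by_cases h : (j : ℕ) % 2 = 0
    · have h' : (j : ℕ) / 2 < n := by omega
      ext
      simp only [h, h', dite_true]
      omega
    · have h' : ¬ n + (j : ℕ) / 2 < n := by omega
      ext
      simp only [h, h', dite_false]
      omega

/-- The shuffled componentwise multiplication `M^{⊗ n} ⊗ M^{⊗ n} ⟶ M^{⊗ n}`. -/
def shuffleMul (M : C) (m : M ⊗ M ⟶ M) (n : ℕ) : tpow M n ⊗ tpow M n ⟶ tpow M n :=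
  concat M n n ≫ permMap M (shuffle n) ≫ pairMul M m n

/-- A monoid object in symmetric sequences of (not necessarily unital) monoids of `C`, in external
form, so that no coproducts in `C` are needed: a symmetric sequence `A` with multiplications `γ n`
on each `A n`, and a monoid structure `μ`, `η` for the convolution product of sequences, such that
the action of permutations and the maps `μ` and `η` respect the multiplications `γ`. -/
structure IsSymSeqMonoid (A : FTriv → C) (act : ∀ {n m : FTriv}, (n ⟶ m) → (A n ⟶ A m))
    (γ : ∀ n : FTriv, A n ⊗ A n ⟶ A n) (μ : ∀ p q : FTriv, A p ⊗ A q ⟶ A (p ⊗ q))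
    (η : 𝟙_ C ⟶ A (𝟙_ FTriv)) : Prop where
  act_id (n : FTriv) : act (𝟙 n) = 𝟙 (A n)
  act_comp {n m k : FTriv} (σ : n ⟶ m) (τ : m ⟶ k) : act (σ ≫ τ) = act σ ≫ act τ
  γ_assoc (n : FTriv) :
    γ n ▷ A n ≫ γ n = (α_ (A n) (A n) (A n)).hom ≫ A n ◁ γ n ≫ γ n
  γ_act {n m : FTriv} (σ : n ⟶ m) : (act σ ⊗ₘ act σ) ≫ γ m = γ n ≫ act σ
  μ_act {p q p' q' : FTriv} (σ : p ⟶ p') (τ : q ⟶ q') :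
    (act σ ⊗ₘ act τ) ≫ μ p' q' = μ p q ≫ act (σ ⊗ₘ τ)
  μ_assoc (p q r : FTriv) :
    μ p q ▷ A r ≫ μ (p ⊗ q) r ≫ act (α_ p q r).hom =
      (α_ (A p) (A q) (A r)).hom ≫ A p ◁ μ q r ≫ μ p (q ⊗ r)
  μ_left_unit (n : FTriv) : η ▷ A n ≫ μ (𝟙_ FTriv) n ≫ act (λ_ n).hom = (λ_ (A n)).hom
  μ_right_unit (n : FTriv) : A n ◁ η ≫ μ n (𝟙_ FTriv) ≫ act (ρ_ n).hom = (ρ_ (A n)).hom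
  μ_γ (p q : FTriv) :
    (μ p q ⊗ₘ μ p q) ≫ γ (p ⊗ q) = tensorμ (A p) (A q) (A p) (A q) ≫ (γ p ⊗ₘ γ q) ≫ μ p q
  η_γ : (η ⊗ₘ η) ≫ γ (𝟙_ FTriv) = (λ_ (𝟙_ C)).hom ≫ η

/-- The additional laws making each `A n` a unital monoid with unit `u n` and making the action and
the maps `μ` and `η` morphisms of unital monoids. -/
structure IsUnitalSymSeqMonoid (A : FTriv → C) (act : ∀ {n m : FTriv}, (n ⟶ m) → (A n ⟶ A m))
    (γ : ∀ n : FTriv, A n ⊗ A n ⟶ A n) (μ : ∀ p q : FTriv, A p ⊗ A q ⟶ A (p ⊗ q))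
    (η : 𝟙_ C ⟶ A (𝟙_ FTriv)) (u : ∀ n : FTriv, 𝟙_ C ⟶ A n) : Prop
    extends IsSymSeqMonoid A act γ μ η where
  u_mul (n : FTriv) : u n ▷ A n ≫ γ n = (λ_ (A n)).hom
  mul_u (n : FTriv) : A n ◁ u n ≫ γ n = (ρ_ (A n)).hom
  u_act {n m : FTriv} (σ : n ⟶ m) : u n ≫ act σ = u m
  u_μ (p q : FTriv) : (λ_ (𝟙_ C)).inv ≫ (u p ⊗ₘ u q) ≫ μ p q = u (p ⊗ q)
  u_η : η = u (𝟙_ FTriv)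

end TensorPower

/-! Everything rests on the recursion `A_{n+1} = A_n ⊗ M`. A bijection is determined by the image of
the last position and by the bijection left after deleting it, and `permMap` is built along this
decomposition. Its functoriality reduces to `insertLast_permMap`, which rests on the exchange of two
insertions (`insertLast_exchange`), whose inductive step is the Yang–Baxter equation.

The shuffled multiplication obeys the same recursion: by `shuffleMul_succ`, `A_{n+1}` is the tensor
product of `A_n` and `M` as objects with a multiplication. In a symmetric monoidal category the
associators, unitors and braidings respect tensor products of multiplications, and multiplicative
morphisms are closed under composition and `⊗`. Permutations and concatenations are built from such
morphisms, so they are multiplicative by induction (`isMulHom_permMap`, `isMulHom_concat`);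
associativity and units pass from `m` to every `A_n` in the same way. This gives the third and
fourth claims.

For existence, the plus construction is given by generators and relations, so an op can be defined
by values on the generators that satisfy the relations (`Presented.lift`). A letter `φ : a ⟶ b` goes
to the tensor power indexed by `a`, and `γ φ₁ φ₀` multiplies after the power indexed by the target
of `φ₀` has been carried back along the inverse of `φ₀`. The relations become the laws of tensor
powers, and `μ` can be inverted because concatenation is an isomorphism.

For the pullback, `n ↦ id_{∗^n}` is a lax braided functor from `FTriv` to its nc-plus construction,
with structure maps `μ` and `ε`. These become invertible after the quotient, so composing with the
op gives a strong braided functor on `FTriv`. Such a functor is compared with tensor powers by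
splitting off one letter at a time (`compareIso`), and the same decomposition of permutations gives
equivariance (`map_compareIso`). The interchange laws say that `μ` and `ε` are multiplicative for
`γ`, so the comparison is multiplicative for all `n` as soon as `e` is (`isMulHom_compareIso`). -/

/-! ## Deleting a point from a bijection -/

/-- The bijection obtained from `σ` by deleting the position `i` and its image. -/
def removeAt {n m : ℕ} (σ : Fin (n + 1) ≃ Fin (m + 1)) (i : Fin (n + 1)) : Fin n ≃ Fin m :=
  Equiv.removeNone ((finSuccEquiv' i).symm.trans (σ.trans (finSuccEquiv' (σ i))))

/-- Since `succAbove` is injective, this equation pins down `removeAt σ i`; later identities between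
deleted bijections are checked through it and not through `Equiv.removeNone`. -/
theorem succAbove_removeAt {n m : ℕ} (σ : Fin (n + 1) ≃ Fin (m + 1)) (i : Fin (n + 1))
    (j : Fin n) : (σ i).succAbove (removeAt σ i j) = σ (i.succAbove j) := by
  -- The conjugated bijection of `Option` types therefore does not take the value `none` at `some
  -- j`, which is the case where `removeNone` simply restricts.
  have hne : σ (i.succAbove j) ≠ σ i := fun h => Fin.succAbove_ne i j (σ.injective h)
  obtain ⟨k, hk⟩ := Fin.exists_succAbove_eq hne
  have h := Equiv.removeNone_some
    ((finSuccEquiv' i).symm.trans (σ.trans (finSuccEquiv' (σ i)))) (x := j)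
    ⟨k, by simp [← hk]⟩
  have h' : some (removeAt σ i j) = some k := by
    refine h.trans ?_
    simp [← hk]
  rw [Option.some.inj h', hk]

theorem removeAt_eq_of_succAbove {n m : ℕ} {σ : Fin (n + 1) ≃ Fin (m + 1)} {i : Fin (n + 1)}
    {τ : Fin n ≃ Fin m} (h : ∀ j, (σ i).succAbove (τ j) = σ (i.succAbove j)) :
    removeAt σ i = τ := by
  ext j : 1
  exact Fin.succAbove_right_injective ((succAbove_removeAt σ i j).trans (h j).symm)

theorem dropLast_eq_of_succAbove {n m : ℕ} {σ : Fin (n + 1) ≃ Fin (m + 1)}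
    {τ : Fin n ≃ Fin m} (h : ∀ j, (σ (Fin.last n)).succAbove (τ j) = σ j.castSucc) :
    dropLast σ = τ :=
  removeAt_eq_of_succAbove fun j => by rw [h, Fin.succAbove_last]

theorem succAbove_dropLast {n m : ℕ} (σ : Fin (n + 1) ≃ Fin (m + 1)) (j : Fin n) :
    (σ (Fin.last n)).succAbove (dropLast σ j) = σ j.castSucc := by
  rw [← Fin.succAbove_last_apply j]
  exact succAbove_removeAt σ (Fin.last n) j

/-! ## Exchanging the last two factors -/

section

variable {C : Type u} [Category.{v} C] [MonoidalCategory C] [SymmetricCategory C]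

/-- The exchange of the last two factors of a threefold tensor product. -/
def swapLast (X Y Z : C) : (X ⊗ Y) ⊗ Z ⟶ (X ⊗ Z) ⊗ Y :=
  (α_ X Y Z).hom ≫ X ◁ (β_ Y Z).hom ≫ (α_ X Z Y).inv

@[simp]
theorem swapLast_swapLast (X Y Z : C) : swapLast X Y Z ≫ swapLast X Z Y = 𝟙 _ := by
  simp [swapLast, ← whiskerLeft_comp_assoc]

@[simp]
theorem swapLast_swapLast_assoc (X Y Z : C) {W : C} (f : (X ⊗ Y) ⊗ Z ⟶ W) :
    swapLast X Y Z ≫ swapLast X Z Y ≫ f = f := by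
  rw [← Category.assoc, swapLast_swapLast, Category.id_comp]

theorem swapLast_naturality {X X' Y Y' Z Z' : C} (f : X ⟶ X') (g : Y ⟶ Y') (h : Z ⟶ Z') :
    ((f ⊗ₘ g) ⊗ₘ h) ≫ swapLast X' Y' Z' = swapLast X Y Z ≫ ((f ⊗ₘ h) ⊗ₘ g) := by
  simp only [swapLast, associator_naturality_assoc, Category.assoc]
  rw [← associator_inv_naturality, ← id_tensorHom, ← id_tensorHom,
    tensorHom_comp_tensorHom_assoc, tensorHom_comp_tensorHom_assoc]
  simp [BraidedCategory.braiding_naturality]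

theorem whiskerRight_swapLast {X X' : C} (f : X ⟶ X') (Y Z : C) :
    f ▷ Y ▷ Z ≫ swapLast X' Y Z = swapLast X Y Z ≫ f ▷ Z ▷ Y := by
  simpa using swapLast_naturality f (𝟙 Y) (𝟙 Z)

theorem whiskerRight_swapLast_assoc {X X' : C} (f : X ⟶ X') (Y Z : C) {W : C}
    (g : (X' ⊗ Z) ⊗ Y ⟶ W) :
    f ▷ Y ▷ Z ≫ swapLast X' Y Z ≫ g = swapLast X Y Z ≫ f ▷ Z ▷ Y ≫ g := by
  rw [← Category.assoc, whiskerRight_swapLast, Category.assoc]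

/-- This is the Yang–Baxter equation for `Y`, `Z`, `W`, whiskered by `X` and rebracketed to the
left. -/
theorem swapLast_yang_baxter (X Y Z W : C) :
    swapLast (X ⊗ Y) Z W ≫ swapLast X Y W ▷ Z ≫ swapLast (X ⊗ W) Y Z =
      swapLast X Y Z ▷ W ≫ swapLast (X ⊗ Z) Y W ≫ swapLast X Z W ▷ Y := by
  have h := congrArg (fun t => (α_ (X ⊗ Y) Z W).hom ≫ (α_ X Y (Z ⊗ W)).hom ≫ X ◁ t ≫
    (α_ X W (Z ⊗ Y)).inv ≫ (α_ (X ⊗ W) Z Y).inv) (BraidedCategory.yang_baxter Y Z W)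
  simp only [swapLast]
  calc _ = _ := by monoidal
    _ = _ := h.symm
    _ = _ := by monoidal

/-- Inductive step of `insertLast_exchange` with the insertions abstracted. Naturality moves the
second swap in front of `f`, respectively `f'`; after the hypothesis is applied, both sides differ
by Yang–Baxter. -/
theorem swapLast_exchange {X Y Z M : C} {f f' : X ⊗ M ⟶ Y} {g g' : Y ⊗ M ⟶ Z}
    (h : swapLast X M M ≫ f ▷ M ≫ g = f' ▷ M ≫ g') :
    swapLast (X ⊗ M) M M ≫ (swapLast X M M ≫ f ▷ M) ▷ M ≫ swapLast Y M M ≫ g ▷ M =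
      (swapLast X M M ≫ f' ▷ M) ▷ M ≫ swapLast Y M M ≫ g' ▷ M := by
  simp only [comp_whiskerRight, Category.assoc, whiskerRight_swapLast_assoc]
  rw [← comp_whiskerRight, ← comp_whiskerRight, ← h]
  simp only [comp_whiskerRight]
  have := swapLast_yang_baxter X M M M =≫ (f ▷ M ▷ M ≫ g ▷ M)
  simpa only [Category.assoc] using this

/-! ## Functoriality of the permutation action -/

variable (M : C)

theorem insertLast_last (n : ℕ) : insertLast M n (Fin.last n) = 𝟙 (tpow M (n + 1)) := by
  cases n <;> simp [insertLast] <;> rfl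

theorem insertLast_castSucc (n : ℕ) (i : Fin (n + 1)) :
    insertLast M (n + 1) i.castSucc =
      swapLast (tpow M n) M M ≫ insertLast M n i ▷ M := by
  have h : i.castSucc ≠ Fin.last (n + 1) := i.castSucc_lt_last.ne
  simp [insertLast, h, swapLast]
  rfl

theorem permMap_succ {n m : ℕ} (σ : Fin (n + 1) ≃ Fin (m + 1)) :
    permMap M σ = permMap M (dropLast σ) ▷ M ≫ insertLast M m (σ (Fin.last n)) := by
  rw [permMap]
  rfl

theorem val_succAbove {n : ℕ} (a : Fin (n + 1)) (b : Fin n) :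
    (a.succAbove b : ℕ) = if (b : ℕ) < a then (b : ℕ) else b + 1 := by
  simp only [Fin.succAbove, Fin.lt_def, Fin.val_castSucc]
  split_ifs <;> simp

/-- Both sides put the last factor at `b'` and the one before it at `b`; the hypotheses express
these final positions for the two orders of insertion. If `b` is last, nothing has to be moved past;
if `b'` is last, two swaps cancel by symmetry; otherwise all positions lie below the last and
Yang–Baxter gives the induction. -/
theorem insertLast_exchange : ∀ (n : ℕ) (a a' : Fin (n + 1)) (b b' : Fin (n + 2)),
    b.succAbove a = b' → b'.succAbove a' = b →
    swapLast (tpow M n) M M ≫ insertLast M n a ▷ M ≫ insertLast M (n + 1) b =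
      insertLast M n a' ▷ M ≫ insertLast M (n + 1) b' := by
  intro n a a' b b' h h'
  simp only [Fin.ext_iff, val_succAbove] at h h'
  induction b using Fin.lastCases with
  | last =>
    obtain rfl : a' = Fin.last n := by ext; simp at *; split_ifs at * <;> omega
    obtain rfl : b' = a.castSucc := by ext; simp at *; split_ifs at * <;> omega
    -- Stated for arbitrary objects, because `tpow M (n + 1)` and `tpow M n ⊗ M` agree only after
    -- unfolding and rewriting would not see it. The other `key` statements about tensor powers
    -- serve the same purpose.
    have key : ∀ {X Y : C} (f : X ⊗ M ⟶ Y), swapLast X M M ≫ f ▷ M ≫ 𝟙 (Y ⊗ M) =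
      𝟙 (X ⊗ M) ▷ M ≫ swapLast X M M ≫ f ▷ M := by simp
    rw [insertLast_castSucc, insertLast_last, insertLast_last]
    exact key (insertLast M n a)
  | cast b =>
    induction b' using Fin.lastCases with
    | last =>
      obtain rfl : a = Fin.last n := by ext; simp at *; split_ifs at * <;> omega
      obtain rfl : a' = b := by ext; simp at *; split_ifs at * <;> omega
      have key : ∀ {X Y : C} (f : X ⊗ M ⟶ Y),
          swapLast X M M ≫ 𝟙 (X ⊗ M) ▷ M ≫ swapLast X M M ≫ f ▷ M = f ▷ M ≫ 𝟙 (Y ⊗ M) := by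
        simp
      rw [insertLast_castSucc, insertLast_last, insertLast_last]
      exact key (insertLast M n a')
    | cast b' =>
      cases n with
      | zero => exfalso; simp at *
      | succ n =>
        induction a using Fin.lastCases with
        | last => exfalso; simp at *; split_ifs at * <;> omega
        | cast a =>
          induction a' using Fin.lastCases with
          | last => exfalso; simp at *; split_ifs at * <;> omega
          | cast a' =>
            rw [insertLast_castSucc M (n + 1) b, insertLast_castSucc M (n + 1) b',
              insertLast_castSucc M n a, insertLast_castSucc M n a']
            refine swapLast_exchange (insertLast_exchange n a a' b b' ?_ ?_)
            all_goals simpa only [Fin.ext_iff, val_succAbove] using by assumption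

/-- Both composites are the order-preserving embedding that misses exactly the two points `b` and
`b'`. -/
theorem succAbove_succAbove_comm {n : ℕ} {a a' : Fin (n + 1)} {b b' : Fin (n + 2)}
    (h : b.succAbove a = b') (h' : b'.succAbove a' = b) (x : Fin n) :
    b'.succAbove (a'.succAbove x) = b.succAbove (a.succAbove x) := by
  simp only [Fin.ext_iff, val_succAbove] at *
  split_ifs at * <;> omega

theorem removeAt_castSucc_last {m k : ℕ} (τ : Fin (m + 2) ≃ Fin (k + 2)) (i : Fin (m + 1)) :
    (τ i.castSucc).succAbove (removeAt τ i.castSucc (Fin.last m)) = τ (Fin.last (m + 1)) := by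
  rw [succAbove_removeAt, Fin.succAbove_of_le_castSucc _ _ (by simpa using Fin.le_last i),
    Fin.succ_last]

theorem dropLast_removeAt {m k : ℕ} (τ : Fin (m + 2) ≃ Fin (k + 2)) (i : Fin (m + 1)) :
    dropLast (removeAt τ i.castSucc) = removeAt (dropLast τ) i := by
  refine dropLast_eq_of_succAbove fun j => ?_
  apply Fin.succAbove_right_injective (p := τ i.castSucc)
  rw [succAbove_removeAt, succAbove_succAbove_comm (succAbove_dropLast τ i)
      (removeAt_castSucc_last τ i), succAbove_removeAt, succAbove_dropLast,
    Fin.castSucc_succAbove_castSucc]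

/-- The inserted factor ends at `τ i` whichever way it travels, and the others move by `τ` with `i`
deleted. When `i` is not last, the factor is first swapped past the final one; induction on
`dropLast τ` handles the remaining positions, and `insertLast_exchange` reorders the two insertions
in the target. -/
theorem insertLast_permMap : ∀ {m k : ℕ} (i : Fin (m + 1)) (τ : Fin (m + 1) ≃ Fin (k + 1)),
    insertLast M m i ≫ permMap M τ =
      permMap M (removeAt τ i) ▷ M ≫ insertLast M k (τ i) := by
  intro m k i τ
  induction i using Fin.lastCases with
  | last =>
    rw [insertLast_last, permMap_succ]
    exact Category.id_comp _
  | cast i =>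
    cases m with
    | zero => exact i.elim0
    | succ m =>
      cases k with
      | zero =>
        exact absurd (τ.injective (Subsingleton.elim (α := Fin 1) _ _))
          (Fin.castSucc_lt_last i).ne
      | succ k =>
        have key : ∀ {X Y Z W U : C} {f : X ⊗ M ⟶ Y} {g : Y ⟶ Z ⊗ M} {h : (Z ⊗ M) ⊗ M ⟶ W}
            {r : X ⟶ U} {a a' : U ⊗ M ⟶ Z ⊗ M} {h' : (Z ⊗ M) ⊗ M ⟶ W}
            (_ : f ≫ g = r ▷ M ≫ a) (_ : swapLast U M M ≫ a ▷ M ≫ h = a' ▷ M ≫ h'),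
            (swapLast X M M ≫ f ▷ M) ≫ g ▷ M ≫ h = (r ▷ M ≫ a') ▷ M ≫ h' := by
          intro X Y Z W U f g h r a a' h' e₁ e₂
          rw [Category.assoc, ← comp_whiskerRight_assoc, e₁, comp_whiskerRight_assoc,
            comp_whiskerRight_assoc, ← e₂, whiskerRight_swapLast_assoc]
        rw [insertLast_castSucc, permMap_succ M τ, permMap_succ M (removeAt τ i.castSucc),
          dropLast_removeAt]
        exact key (insertLast_permMap i (dropLast τ))
          (insertLast_exchange M k _ _ _ _ (succAbove_dropLast τ i)
            (removeAt_castSucc_last τ i))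

theorem permMap_zero (σ : Fin 0 ≃ Fin 0) : permMap M σ = 𝟙 (tpow M 0) := by
  rw [permMap]; rfl

@[simp]
theorem permMap_refl : ∀ n : ℕ, permMap M (Equiv.refl (Fin n)) = 𝟙 (tpow M n)
  | 0 => permMap_zero M _
  | n + 1 => by
    rw [permMap_succ, Equiv.refl_apply, insertLast_last,
      dropLast_eq_of_succAbove (τ := Equiv.refl _) (by simp), permMap_refl n]
    exact (Category.comp_id _).trans (id_whiskerRight _ _)

/-- Deleting the last position from a composite deletes `σ (Fin.last n)` from `τ`, so
`insertLast_permMap` is exactly what the recursion needs. -/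
theorem permMap_trans : ∀ {n m k : ℕ} (σ : Fin n ≃ Fin m) (τ : Fin m ≃ Fin k),
    permMap M (σ.trans τ) = permMap M σ ≫ permMap M τ
  | 0, 0, 0, σ, τ => by simp only [permMap_zero]; exact (Category.id_comp _).symm
  | 0, _ + 1, _, σ, _ => (σ.symm 0).elim0
  | _ + 1, 0, _, σ, _ => (σ 0).elim0
  | _, 0, _ + 1, _, τ => (τ.symm 0).elim0
  | _, _ + 1, 0, _, τ => (τ 0).elim0
  | n + 1, m + 1, k + 1, σ, τ => by
    have hd : dropLast (σ.trans τ) = (dropLast σ).trans (removeAt τ (σ (Fin.last n))) :=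
      dropLast_eq_of_succAbove fun j => by
        rw [Equiv.trans_apply, Equiv.trans_apply, succAbove_removeAt, succAbove_dropLast,
          Equiv.trans_apply]
    have key : ∀ {X Y Z U V : C} {f : X ⟶ Y} {a : Y ⊗ M ⟶ Z} {t : Z ⟶ U} {r : Y ⟶ V}
        {b : V ⊗ M ⟶ U} (_ : a ≫ t = r ▷ M ≫ b), (f ≫ r) ▷ M ≫ b = (f ▷ M ≫ a) ≫ t := by
      intro X Y Z U V f a t r b h
      rw [Category.assoc, h, comp_whiskerRight_assoc]
    rw [permMap_succ M σ, permMap_succ M (σ.trans τ), hd, permMap_trans]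
    exact key (insertLast_permMap M _ τ)

end

/-! ## Concatenation and permutations -/

theorem sumMap_last {a b c d : ℕ} (σ : Fin a ≃ Fin b) (τ : Fin (c + 1) ≃ Fin (d + 1)) :
    FTriv.sumMap σ τ (Fin.last (a + c)) = Fin.natAdd b (τ (Fin.last c)) :=
  FTriv.sumMap_natAdd σ τ (Fin.last c)

theorem dropLast_sumMap {a b c d : ℕ} (σ : Fin a ≃ Fin b) (τ : Fin (c + 1) ≃ Fin (d + 1)) :
    dropLast (n := a + c) (m := b + d) (@FTriv.sumMap a b (c + 1) (d + 1) σ τ) =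
      FTriv.sumMap σ (dropLast τ) := by
  refine dropLast_eq_of_succAbove fun j => ?_
  have h := fun j => succAbove_dropLast τ j
  simp only [sumMap_last, Fin.ext_iff, val_succAbove, FTriv.sumMap_val, Fin.val_castSucc,
    Fin.val_natAdd] at h ⊢
  split_ifs with h₁ h₂ h₂
  · rfl
  · omega
  · have := h ⟨j - a, by omega⟩
    rw [if_pos (by omega)] at this
    simp only [this]
    rfl
  · have := h ⟨j - a, by omega⟩
    rw [if_neg (by omega)] at this
    rw [Nat.add_assoc, this]
    rfl

section

variable {C : Type u} [Category.{v} C] [MonoidalCategory C] (M : C)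

theorem concat_zero (p : ℕ) : concat M p 0 = (ρ_ (tpow M p)).hom := rfl

theorem concat_succ (p q : ℕ) :
    concat M p (q + 1) = (α_ (tpow M p) (tpow M q) M).inv ≫ concat M p q ▷ M := rfl

instance isIso_concat (p q : ℕ) : IsIso (concat M p q) := by
  induction q with
  | zero => exact (inferInstance : IsIso (ρ_ (tpow M p)).hom)
  | succ q ih =>
    exact (inferInstance : IsIso ((α_ (tpow M p) (tpow M q) M).inv ≫ concat M p q ▷ M))

variable [SymmetricCategory C]

/-- Nothing is inserted below the last position, so the recursion for `permMap` stops at the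
whiskered part. -/
theorem permMap_of_last {n m : ℕ} {σ : Fin (n + 1) ≃ Fin (m + 1)} {τ : Fin n ≃ Fin m}
    (hl : σ (Fin.last n) = Fin.last m) (h : ∀ j, σ j.castSucc = (τ j).castSucc) :
    permMap M σ = permMap M τ ▷ M := by
  rw [permMap_succ, hl, insertLast_last,
    dropLast_eq_of_succAbove (τ := τ) (by intro j; rw [hl, h, Fin.succAbove_last])]
  exact Category.comp_id _

theorem permMap_finCongr_succ {n m : ℕ} (h : n + 1 = m + 1) (h' : n = m) :
    permMap M (finCongr h) = permMap M (finCongr h') ▷ M :=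
  permMap_of_last M (by ext; simp) (fun j => by ext; simp)

theorem permMap_sumMap_refl_one {n m : ℕ} (σ : Fin n ≃ Fin m) :
    permMap M (FTriv.sumMap σ (Equiv.refl (Fin 1))) = permMap M σ ▷ M :=
  permMap_of_last M (sumMap_last σ (Equiv.refl (Fin 1))) fun j => FTriv.sumMap_castAdd σ _ j

theorem swapLast_tensor_left (X Y Z W : C) :
    (α_ X Y Z).inv ▷ W ≫ swapLast (X ⊗ Y) Z W ≫ (α_ X Y W).hom ▷ Z =
      (α_ X (Y ⊗ Z) W).hom ≫ X ◁ swapLast Y Z W ≫ (α_ X (Y ⊗ W) Z).inv := by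
  simp only [swapLast]
  monoidal

/-- A factor inserted in the right-hand block never crosses the left-hand one; its position is only
shifted by `p`. The induction on `q` matches one swap with its whiskered version by
`swapLast_tensor_left`. -/
theorem concat_insertLast (p : ℕ) : ∀ (q : ℕ) (i : Fin (q + 1)),
    concat M p q ▷ M ≫ insertLast M (p + q) (Fin.natAdd p i) =
      (α_ (tpow M p) (tpow M q) M).hom ≫ tpow M p ◁ insertLast M q i ≫ concat M p (q + 1) := by
  intro q i
  induction i using Fin.lastCases with
  | last =>
    have key : ∀ {X Y Z : C} (f : X ⊗ Y ⟶ Z), f ▷ M ≫ 𝟙 (Z ⊗ M) =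
        (α_ X Y M).hom ≫ X ◁ 𝟙 (Y ⊗ M) ≫ (α_ X Y M).inv ≫ f ▷ M := by simp
    rw [insertLast_last, concat_succ,
      show Fin.natAdd p (Fin.last q) = Fin.last (p + q) from rfl, insertLast_last]
    exact key (concat M p q)
  | cast i =>
    cases q with
    | zero => exact i.elim0
    | succ q =>
      have key : ∀ {X Y Z U : C} {f : X ⊗ Y ⟶ Z} {g : Z ⊗ M ⟶ U} {k : Y ⊗ M ⟶ Y ⊗ M}
          {h : X ⊗ (Y ⊗ M) ⟶ U} (_ : f ▷ M ≫ g = (α_ X Y M).hom ≫ X ◁ k ≫ h),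
          ((α_ X Y M).inv ≫ f ▷ M) ▷ M ≫ swapLast Z M M ≫ g ▷ M =
            (α_ X (Y ⊗ M) M).hom ≫ X ◁ (swapLast Y M M ≫ k ▷ M) ≫
              (α_ X (Y ⊗ M) M).inv ≫ h ▷ M := by
        intro X Y Z U f g k h e
        rw [comp_whiskerRight_assoc, whiskerRight_swapLast_assoc, ← comp_whiskerRight, e,
          comp_whiskerRight, comp_whiskerRight]
        have := swapLast_tensor_left X Y M M =≫ ((X ◁ k) ▷ M ≫ h ▷ M)
        simp only [Category.assoc] at this
        rw [this]
        simp
      have e : insertLast M (p + (q + 1)) (Fin.natAdd p i.castSucc) =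
          swapLast (tpow M (p + q)) M M ≫ insertLast M (p + q) (Fin.natAdd p i) ▷ M :=
        insertLast_castSucc M (p + q) (Fin.natAdd p i)
      rw [e, insertLast_castSucc]
      exact key (concat_insertLast p q i)

/-- Deleting the last position commutes with juxtaposition by the identity on the left, so the
recursion for `permMap` on both sides is matched through `concat_insertLast`. -/
theorem concat_sumMap_right (p : ℕ) : ∀ {q k : ℕ} (τ : Fin q ≃ Fin k),
    tpow M p ◁ permMap M τ ≫ concat M p k =
      concat M p q ≫ permMap M (FTriv.sumMap (Equiv.refl (Fin p)) τ)
  | 0, 0, τ => by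
    obtain rfl : τ = Equiv.refl (Fin 0) := Subsingleton.elim _ _
    rw [FTriv.sumMap_refl, permMap_refl, permMap_refl]
    simp
  | 0, _ + 1, τ => (τ.symm 0).elim0
  | _ + 1, 0, τ => (τ 0).elim0
  | q + 1, k + 1, τ => by
    have key : ∀ {X Y Z U V W T : C} {f : X ⊗ Y ⟶ Z} {d : Y ⟶ U} {i : U ⊗ M ⟶ T}
        {g : X ⊗ U ⟶ V} {s : Z ⟶ V} {j : V ⊗ M ⟶ W} {h : X ⊗ T ⟶ W}
        (_ : X ◁ d ≫ g = f ≫ s) (_ : g ▷ M ≫ j = (α_ X U M).hom ≫ X ◁ i ≫ h),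
        X ◁ (d ▷ M ≫ i) ≫ h = ((α_ X Y M).inv ≫ f ▷ M) ≫ s ▷ M ≫ j := by
      intro X Y Z U V W T f d i g s j h e₁ e₂
      rw [Category.assoc, ← comp_whiskerRight_assoc, ← e₁, comp_whiskerRight_assoc, e₂]
      simp
    rw [permMap_succ M τ,
      permMap_succ (n := p + q) (m := p + k) M
        (@FTriv.sumMap p p (q + 1) (k + 1) (Equiv.refl (Fin p)) τ),
      dropLast_sumMap, sumMap_last]
    exact key (concat_sumMap_right p (dropLast τ)) (concat_insertLast M p k _)

theorem concat_sumMap_left {p p' : ℕ} (σ : Fin p ≃ Fin p') : ∀ q : ℕ,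
    permMap M σ ▷ tpow M q ≫ concat M p' q =
      concat M p q ≫ permMap M (FTriv.sumMap σ (Equiv.refl (Fin q)))
  | 0 => by
    rw [show FTriv.sumMap σ (Equiv.refl (Fin 0)) = σ by
      ext i; exact congrArg Fin.val (FTriv.sumMap_castAdd σ _ i)]
    exact rightUnitor_naturality _
  | q + 1 => by
    have key : ∀ {X Y Z X' Z' : C} {f : X ⟶ X'} {g : X' ⊗ Y ⟶ Z'} {h : X ⊗ Y ⟶ Z} {k : Z ⟶ Z'}
        (_ : f ▷ Y ≫ g = h ≫ k), f ▷ (Y ⊗ M) ≫ (α_ X' Y M).inv ≫ g ▷ M =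
          ((α_ X Y M).inv ≫ h ▷ M) ≫ k ▷ M := by
      intro X Y Z X' Z' f g h k e
      rw [Category.assoc, ← comp_whiskerRight, ← e]
      simp
    rw [permMap_of_last (n := p + q) (m := p' + q) M
      (τ := FTriv.sumMap σ (Equiv.refl (Fin q))) (sumMap_last σ _) (fun j => by
        ext; simp [FTriv.sumMap_val])]
    exact key (concat_sumMap_left σ q)

theorem concat_sumMap {p p' q q' : ℕ} (σ : Fin p ≃ Fin p') (τ : Fin q ≃ Fin q') :
    (permMap M σ ⊗ₘ permMap M τ) ≫ concat M p' q' =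
      concat M p q ≫ permMap M (FTriv.sumMap σ τ) := by
  rw [MonoidalCategory.tensorHom_def, Category.assoc, concat_sumMap_right, ← Category.assoc,
    concat_sumMap_left, Category.assoc, ← permMap_trans, FTriv.sumMap_trans]
  rfl

/-- The lengths `p + q + r` and `p + (q + r)` are equal but not definitionally so for variable `r`;
the cast enters as the action of an order-preserving bijection, which fixes the last position and so
is whiskered along the induction. -/
theorem concat_assoc (p q : ℕ) : ∀ r : ℕ,
    concat M p q ▷ tpow M r ≫ concat M (p + q) r ≫ permMap M (finCongr (Nat.add_assoc p q r)) =
      (α_ (tpow M p) (tpow M q) (tpow M r)).hom ≫ tpow M p ◁ concat M q r ≫ concat M p (q + r)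
  | 0 => by
    have key : ∀ {X Y Z : C} (f : X ⊗ Y ⟶ Z), f ▷ 𝟙_ C ≫ (ρ_ Z).hom ≫ 𝟙 Z =
        (α_ X Y (𝟙_ C)).hom ≫ X ◁ (ρ_ Y).hom ≫ f := by simp
    rw [show permMap M (finCongr (Nat.add_assoc p q 0)) = 𝟙 _ from permMap_refl M (p + q)]
    exact key (concat M p q)
  | r + 1 => by
    have key : ∀ {X Y Z U V W T : C} {f : X ⊗ Y ⟶ Z} {g : Z ⊗ W ⟶ U} {k : U ⟶ V}
        {a : Y ⊗ W ⟶ T} {b : X ⊗ T ⟶ V}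
        (_ : f ▷ W ≫ g ≫ k = (α_ X Y W).hom ≫ X ◁ a ≫ b),
        f ▷ (W ⊗ M) ≫ ((α_ Z W M).inv ≫ g ▷ M) ≫ k ▷ M =
          (α_ X Y (W ⊗ M)).hom ≫ X ◁ ((α_ Y W M).inv ≫ a ▷ M) ≫ (α_ X T M).inv ≫ b ▷ M := by
      intro X Y Z U V W T f g k a b e
      have := congrArg (fun t => (α_ (X ⊗ Y) W M).inv ≫ t ▷ M) e
      simp only [comp_whiskerRight] at this
      simp only [Category.assoc, whiskerRight_tensor, Iso.hom_inv_id_assoc]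
      rw [this]
      simp
    rw [permMap_finCongr_succ M (n := p + q + r) (m := p + (q + r)) _ (Nat.add_assoc p q r)]
    exact key (concat_assoc p q r)

theorem concat_zero_left : ∀ n : ℕ,
    concat M 0 n ≫ permMap M (finCongr (Nat.zero_add n)) = (λ_ (tpow M n)).hom
  | 0 => by
    rw [show permMap M (finCongr (Nat.zero_add 0)) = 𝟙 _ from permMap_refl M 0, concat_zero]
    exact (Category.comp_id _).trans unitors_equal.symm
  | n + 1 => by
    have key : ∀ {X Y : C} {f : 𝟙_ C ⊗ X ⟶ Y} {g : Y ⟶ X} (_ : f ≫ g = (λ_ X).hom),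
        ((α_ (𝟙_ C) X M).inv ≫ f ▷ M) ≫ g ▷ M = (λ_ (X ⊗ M)).hom := by
      intro X Y f g e
      rw [Category.assoc, ← comp_whiskerRight, e]
      simp
    rw [permMap_finCongr_succ M (n := 0 + n) (m := n) _ (Nat.zero_add n)]
    exact key (concat_zero_left n)

end

/-! ## Concatenation and the braiding -/

/-- The bijection that moves position `p` to the end and keeps the order of the others. -/
def moveLast (p q : ℕ) : Fin (p + 1 + q) ≃ Fin (p + q + 1) where
  toFun i := ⟨if (i : ℕ) < p then (i : ℕ) else if (i : ℕ) = p then p + q else i - 1, by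
    split_ifs <;> omega⟩
  invFun i := ⟨if (i : ℕ) < p then (i : ℕ) else if (i : ℕ) = p + q then p else i + 1, by
    split_ifs <;> omega⟩
  left_inv i := by
    ext
    dsimp only
    split_ifs <;> omega
  right_inv i := by
    ext
    dsimp only
    split_ifs <;> omega

theorem moveLast_val {p q : ℕ} (i : Fin (p + 1 + q)) :
    (moveLast p q i : ℕ) =
      if (i : ℕ) < p then (i : ℕ) else if (i : ℕ) = p then p + q else i - 1 :=
  rfl

section

variable {C : Type u} [Category.{v} C] [MonoidalCategory C] [SymmetricCategory C]

theorem swapLast_unit_right (X Y : C) :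
    swapLast X Y (𝟙_ C) ≫ (ρ_ X).hom ▷ Y = (ρ_ (X ⊗ Y)).hom := by
  simp [swapLast]

theorem swapLast_tensor_right (X Y Z W : C) :
    swapLast X Y (Z ⊗ W) ≫ (α_ X Z W).inv ▷ Y =
      (α_ (X ⊗ Y) Z W).inv ≫ swapLast X Y Z ▷ W ≫ swapLast (X ⊗ Z) Y W := by
  simp only [swapLast, BraidedCategory.braiding_tensor_right_hom]
  monoidal

theorem swapLast_braiding (X Y Z : C) :
    swapLast X Y Z ≫ (β_ X Z).hom ▷ Y = (β_ (X ⊗ Y) Z).hom ≫ (α_ Z X Y).inv := by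
  simp [swapLast, BraidedCategory.braiding_tensor_left_hom]

theorem swapLast_eq_tensorμ (X Y Z W : C) :
    (α_ (X ⊗ Y) Z W).inv ≫ swapLast X Y Z ▷ W ≫ (α_ (X ⊗ Z) Y W).hom = tensorμ X Y Z W := by
  simp only [swapLast, tensorμ]
  monoidal

variable (M : C)

/-- The last factor of the left block has to cross the whole right block. Adding a factor to the
right block adds one crossing, by the hexagon in the form `swapLast_tensor_right`. Both the block
flip and the shuffle are peeled off by this lemma. -/
theorem concat_moveLast (p : ℕ) : ∀ q : ℕ,
    concat M (p + 1) q ≫ permMap M (moveLast p q) =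
      swapLast (tpow M p) M (tpow M q) ≫ concat M p q ▷ M
  | 0 => by
    have e : moveLast p 0 = Equiv.refl (Fin (p + 1)) := by
      ext i; simp only [moveLast_val, Equiv.refl_apply]; split_ifs <;> omega
    rw [e, permMap_refl]
    exact (Category.comp_id _).trans (swapLast_unit_right _ _).symm
  | q + 1 => by
    have key : ∀ {X Y Z W : C} {f : (X ⊗ M) ⊗ Y ⟶ Z} {r : Z ⟶ W ⊗ M} {c : X ⊗ Y ⟶ W}
        (_ : f ≫ r = swapLast X M Y ≫ c ▷ M),
        ((α_ (X ⊗ M) Y M).inv ≫ f ▷ M) ≫ r ▷ M ≫ swapLast W M M ≫ 𝟙 (W ⊗ M) ▷ M =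
          swapLast X M (Y ⊗ M) ≫ ((α_ X Y M).inv ≫ c ▷ M) ▷ M := by
      intro X Y Z W f r c e
      rw [id_whiskerRight, Category.comp_id, Category.assoc, ← comp_whiskerRight_assoc, e,
        comp_whiskerRight_assoc, whiskerRight_swapLast, comp_whiskerRight,
        ← Category.assoc (swapLast X M (Y ⊗ M)), swapLast_tensor_right]
      simp only [Category.assoc]
    have hl : moveLast p (q + 1) (Fin.last (p + 1 + q)) = (Fin.last (p + q)).castSucc := by
      ext; simp only [moveLast_val, Fin.val_last, Fin.val_castSucc]; split_ifs <;> omega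
    have hd : dropLast (n := p + 1 + q) (m := p + q + 1) (moveLast p (q + 1)) = moveLast p q :=
      dropLast_eq_of_succAbove fun j => by
        rw [hl]
        ext
        simp only [moveLast_val, val_succAbove, Fin.val_last, Fin.val_castSucc]
        split_ifs <;> omega
    have e : permMap M (moveLast p (q + 1)) = permMap M (moveLast p q) ▷ M ≫
        swapLast (tpow M (p + q)) M M ≫ 𝟙 (tpow M (p + q) ⊗ M) ▷ M := by
      refine (permMap_succ (n := p + 1 + q) (m := p + q + 1) M _).trans ?_
      rw [hl, hd, insertLast_castSucc, insertLast_last]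
      rfl
    rw [e]
    exact key (concat_moveLast p q)

/-- To flip blocks of lengths `p + 1` and `q`, send the last factor of the first block to the end,
then flip the blocks of lengths `p` and `q` in front of it; the hexagon assembles the two crossings
into one braiding. -/
theorem concat_finAddFlip : ∀ p q : ℕ,
    concat M p q ≫ permMap M finAddFlip = (β_ (tpow M p) (tpow M q)).hom ≫ concat M q p
  | 0, q => by
    -- An empty block makes the flip a mere cast, so this case is left unitality of concatenation.
    have e : (finAddFlip : Fin (0 + q) ≃ Fin (q + 0)) = finCongr (Nat.zero_add q) := by
      ext i
      rw [FTriv.finAddFlip_val]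
      simp
    have h : permMap M (finAddFlip : Fin (0 + q) ≃ Fin (q + 0)) =
      permMap M (finCongr (Nat.zero_add q)) := by rw [e]
    rw [h]
    refine (concat_zero_left M q).trans ?_
    exact (braiding_rightUnitor _).symm
  | p + 1, q => by
    have key : ∀ {X Y Z W U : C} {f : (X ⊗ M) ⊗ Y ⟶ Z} {r : Z ⟶ W ⊗ M} {c : X ⊗ Y ⟶ W}
        {s : W ⟶ U} {d : Y ⊗ X ⟶ U} (_ : f ≫ r = swapLast X M Y ≫ c ▷ M)
        (_ : c ≫ s = (β_ X Y).hom ≫ d),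
        f ≫ r ≫ s ▷ M = (β_ (X ⊗ M) Y).hom ≫ (α_ Y X M).inv ≫ d ▷ M := by
      intro X Y Z W U f r c s d e₁ e₂
      rw [← Category.assoc f, e₁, Category.assoc, ← comp_whiskerRight, e₂, comp_whiskerRight,
        ← Category.assoc (swapLast X M Y), swapLast_braiding, Category.assoc]
    have e : (finAddFlip : Fin (p + 1 + q) ≃ Fin (q + (p + 1))) =
        (moveLast p q).trans (FTriv.sumMap finAddFlip (Equiv.refl (Fin 1))) := by
      ext i
      simp only [FTriv.finAddFlip_val, Equiv.trans_apply, FTriv.sumMap_val, moveLast_val,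
        Equiv.refl_apply]
      split_ifs <;> omega
    have h : permMap M (finAddFlip : Fin (p + 1 + q) ≃ Fin (q + (p + 1))) =
        permMap M (moveLast p q) ≫ permMap M (finAddFlip : Fin (p + q) ≃ Fin (q + p)) ▷ M := by
      rw [e, permMap_trans]
      exact congrArg _ (permMap_sumMap_refl_one M _)
    rw [h]
    exact key (concat_moveLast M p q) (concat_finAddFlip p q)

/-! ## The shuffled multiplication -/

/-- The multiplication on the tensor product of two objects with a multiplication. -/
def tensorMul {A B : C} (a : A ⊗ A ⟶ A) (b : B ⊗ B ⟶ B) : (A ⊗ B) ⊗ (A ⊗ B) ⟶ A ⊗ B :=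
  tensorμ A B A B ≫ (a ⊗ₘ b)

variable {M} (m : M ⊗ M ⟶ M)

theorem shuffleMul_zero : shuffleMul M m 0 = (λ_ (𝟙_ C)).hom := by
  have e : permMap M (shuffle 0) = 𝟙 (tpow M 0) := permMap_zero M _
  rw [shuffleMul, e]
  refine (congrArg _ (Category.id_comp _)).trans ?_
  exact (Category.comp_id _).trans unitors_equal.symm

/-- The shuffle on `2 (n + 1)` factors fixes the final one, sends the last factor of the first block
to the place just before it, and shuffles the rest. By `concat_moveLast` that middle move is the
interchange `tensorμ`. This recursion reduces statements about the shuffled multiplication to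
statements about `tensorMul`. -/
theorem shuffleMul_succ (n : ℕ) :
    shuffleMul M m (n + 1) = tensorMul (shuffleMul M m n) m := by
  have e' : permMap M (shuffle (n + 1)) =
      permMap M ((moveLast n n).trans (FTriv.sumMap (shuffle n) (Equiv.refl (Fin 1)))) ▷ M := by
    refine permMap_of_last (n := n + 1 + n) (m := 2 * n + 1) M ?_ fun j => ?_
    · ext; simp [shuffle]
    · ext
      simp [shuffle, FTriv.sumMap_val, moveLast_val]
      split_ifs <;> simp <;> omega
  have e : permMap M (shuffle (n + 1)) =
      (permMap M (moveLast n n) ≫ permMap M (shuffle n) ▷ M) ▷ M := by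
    rw [e', permMap_trans]
    exact congrArg (fun t => (permMap M (moveLast n n) ≫ t) ▷ M) (permMap_sumMap_refl_one M _)
  have key : ∀ {X Z W U V : C} {f : (X ⊗ M) ⊗ X ⟶ Z} {r : Z ⟶ W ⊗ M} {c : X ⊗ X ⟶ W}
      {s : W ⟶ U} {t : U ⟶ V} (_ : f ≫ r = swapLast X M X ≫ c ▷ M),
      ((α_ (X ⊗ M) X M).inv ≫ f ▷ M) ≫ (r ≫ s ▷ M) ▷ M ≫ (α_ U M M).hom ≫ (t ⊗ₘ m) =
        tensorμ X M X M ≫ ((c ≫ s ≫ t) ⊗ₘ m) := by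
    intro X Z W U V f r c s t h
    rw [Category.assoc, ← comp_whiskerRight_assoc, ← Category.assoc f, h,
      ← swapLast_eq_tensorμ]
    simp [MonoidalCategory.tensorHom_def]
  rw [shuffleMul, e]
  exact key (concat_moveLast M n n)

end

/-! ## Morphisms of objects with a multiplication -/

section

variable {C : Type u} [Category.{v} C] [MonoidalCategory C]

theorem comp_tensorHom {X Y Z U V : C} (f : X ⟶ Y) (g : Y ⟶ Z) (h : U ⟶ V) :
    (f ≫ g) ⊗ₘ h = f ▷ U ≫ (g ⊗ₘ h) := by
  rw [← tensorHom_id, tensorHom_comp_tensorHom, Category.id_comp]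

theorem tensorHom_comp {X Y Z U V : C} (h : U ⟶ V) (f : X ⟶ Y) (g : Y ⟶ Z) :
    h ⊗ₘ (f ≫ g) = U ◁ f ≫ (h ⊗ₘ g) := by
  rw [← id_tensorHom, tensorHom_comp_tensorHom, Category.id_comp]

theorem comp_tensorHom_eq_tensorHom_whiskerRight {X Y Z U V : C} (f : X ⟶ Y) (g : Y ⟶ Z)
    (h : U ⟶ V) : (f ≫ g) ⊗ₘ h = (f ⊗ₘ h) ≫ g ▷ V := by
  rw [← tensorHom_id, tensorHom_comp_tensorHom, Category.comp_id]

/-- Compatibility of a morphism with multiplications on its source and target. -/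
def IsMulHom {A B : C} (a : A ⊗ A ⟶ A) (b : B ⊗ B ⟶ B) (f : A ⟶ B) : Prop :=
  (f ⊗ₘ f) ≫ b = a ≫ f

namespace IsMulHom

theorem id {A : C} (a : A ⊗ A ⟶ A) : IsMulHom a a (𝟙 A) := by simp [IsMulHom]

theorem comp {A B D : C} {a : A ⊗ A ⟶ A} {b : B ⊗ B ⟶ B} {d : D ⊗ D ⟶ D} {f : A ⟶ B} {g : B ⟶ D}
    (hf : IsMulHom a b f) (hg : IsMulHom b d g) : IsMulHom a d (f ≫ g) := by
  unfold IsMulHom at *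
  rw [← tensorHom_comp_tensorHom, Category.assoc, hg, ← Category.assoc, hf, Category.assoc]

theorem inv {A B : C} {a : A ⊗ A ⟶ A} {b : B ⊗ B ⟶ B} {f : A ≅ B}
    (hf : IsMulHom a b f.hom) : IsMulHom b a f.inv := by
  unfold IsMulHom at *
  rw [← cancel_mono f.hom, Category.assoc, ← hf, ← Category.assoc, tensorHom_comp_tensorHom]
  simp

variable [SymmetricCategory C]

theorem tensor {A B A' B' : C} {a : A ⊗ A ⟶ A} {b : B ⊗ B ⟶ B} {a' : A' ⊗ A' ⟶ A'}
    {b' : B' ⊗ B' ⟶ B'} {f : A ⟶ B} {g : A' ⟶ B'} (hf : IsMulHom a b f) (hg : IsMulHom a' b' g) :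
    IsMulHom (tensorMul a a') (tensorMul b b') (f ⊗ₘ g) := by
  unfold IsMulHom tensorMul at *
  rw [tensorμ_natural_assoc, tensorHom_comp_tensorHom, hf, hg, Category.assoc,
    tensorHom_comp_tensorHom]

theorem whiskerRight {A B A' : C} {a : A ⊗ A ⟶ A} {b : B ⊗ B ⟶ B} {f : A ⟶ B}
    (hf : IsMulHom a b f) (a' : A' ⊗ A' ⟶ A') :
    IsMulHom (tensorMul a a') (tensorMul b a') (f ▷ A') := by
  rw [← tensorHom_id]
  exact hf.tensor (.id a')

theorem whiskerLeft {A B A' : C} {a : A ⊗ A ⟶ A} {b : B ⊗ B ⟶ B} {f : A ⟶ B}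
    (a' : A' ⊗ A' ⟶ A') (hf : IsMulHom a b f) :
    IsMulHom (tensorMul a' a) (tensorMul a' b) (A' ◁ f) := by
  rw [← id_tensorHom]
  exact (IsMulHom.id a').tensor hf

/-- Rebracketing intertwines the two iterated middle interchanges, by `associator_monoidal`; the
multiplications then pass through by naturality. -/
theorem associator {A B D : C} (a : A ⊗ A ⟶ A) (b : B ⊗ B ⟶ B) (d : D ⊗ D ⟶ D) :
    IsMulHom (tensorMul (tensorMul a b) d) (tensorMul a (tensorMul b d)) (α_ A B D).hom := by
  refine Eq.symm ?_
  unfold tensorMul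
  simp only [Category.assoc]
  slice_lhs 2 3 => rw [← Category.id_comp d, ← tensorHom_comp_tensorHom]
  slice_lhs 3 4 => rw [associator_naturality]
  slice_rhs 3 4 => rw [← Category.id_comp a, ← tensorHom_comp_tensorHom]
  simp only [tensorHom_id, id_tensorHom]
  slice_lhs 1 3 => rw [associator_monoidal]
  simp only [Category.assoc]

theorem rightUnitor {A : C} (a : A ⊗ A ⟶ A) :
    IsMulHom (tensorMul a (λ_ (𝟙_ C)).hom) a (ρ_ A).hom := by
  refine Eq.symm ?_
  unfold tensorMul
  rw [← Category.id_comp a, ← Category.comp_id (λ_ (𝟙_ C)).hom, ← tensorHom_comp_tensorHom]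
  simp only [tensorHom_id, id_tensorHom]
  slice_lhs 3 4 => rw [rightUnitor_naturality]
  slice_lhs 1 3 => rw [← rightUnitor_monoidal]
  simp only [Category.id_comp]

theorem leftUnitor {A : C} (a : A ⊗ A ⟶ A) :
    IsMulHom (tensorMul (λ_ (𝟙_ C)).hom a) a (λ_ A).hom := by
  refine Eq.symm ?_
  unfold tensorMul
  rw [← Category.id_comp a, ← Category.comp_id (λ_ (𝟙_ C)).hom, ← tensorHom_comp_tensorHom]
  simp only [tensorHom_id, id_tensorHom]
  slice_lhs 3 4 => rw [leftUnitor_naturality]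
  slice_lhs 1 3 => rw [← leftUnitor_monoidal]
  simp only [Category.id_comp]

/-- After expanding the block braidings, the middle factors cross twice. The two crossings cancel by
symmetry; a general braiding would not suffice for this argument. -/
theorem braiding {A B : C} (a : A ⊗ A ⟶ A) (b : B ⊗ B ⟶ B) :
    IsMulHom (tensorMul a b) (tensorMul b a) (β_ A B).hom := by
  refine Eq.symm ?_
  unfold tensorMul
  simp only [tensorμ, Category.assoc, BraidedCategory.braiding_naturality,
    BraidedCategory.braiding_tensor_right_hom, BraidedCategory.braiding_tensor_left_hom,
    comp_whiskerRight, whisker_assoc, whiskerLeft_comp, pentagon_assoc,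
    pentagon_inv_hom_hom_hom_inv_assoc, Iso.inv_hom_id_assoc, whiskerLeft_hom_inv_assoc]
  slice_lhs 3 4 =>
    rw [← whiskerLeft_comp, ← comp_whiskerRight, SymmetricCategory.symmetry]
  simp only [id_whiskerRight, whiskerLeft_id, Category.id_comp, Category.assoc, pentagon_inv_assoc,
    Iso.hom_inv_id_assoc]
  slice_lhs 1 2 =>
    rw [← associator_inv_naturality_left]
  slice_lhs 2 3 =>
    rw [Iso.inv_hom_id]
  rw [Category.id_comp]
  slice_lhs 2 3 =>
    rw [← associator_naturality_right]
  slice_lhs 1 2 =>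
    rw [← MonoidalCategory.tensorHom_def]
  simp only [Category.assoc]

theorem swapLast {A B D : C} (a : A ⊗ A ⟶ A) (b : B ⊗ B ⟶ B) (d : D ⊗ D ⟶ D) :
    IsMulHom (tensorMul (tensorMul a b) d) (tensorMul (tensorMul a d) b) (swapLast A B D) :=
  (associator a b d).comp ((whiskerLeft a (braiding b d)).comp (associator a d b).inv)

end IsMulHom

theorem unitPow_concat {M : C} (u : 𝟙_ C ⟶ M) (p : ℕ) : ∀ q : ℕ,
    (λ_ (𝟙_ C)).inv ≫ (unitPow M u p ⊗ₘ unitPow M u q) ≫ concat M p q = unitPow M u (p + q)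
  | 0 => by
    have key : ∀ {X : C} {v : 𝟙_ C ⟶ X},
        (λ_ (𝟙_ C)).inv ≫ (v ⊗ₘ 𝟙 (𝟙_ C)) ≫ (ρ_ X).hom = v := by
      intro X v
      simp [← unitors_equal]
    exact key
  | q + 1 => by
    have key : ∀ {X Y Z : C} {v : 𝟙_ C ⟶ X} {w : 𝟙_ C ⟶ Y} {z : 𝟙_ C ⟶ Z} {f : X ⊗ Y ⟶ Z}
        (_ : (λ_ (𝟙_ C)).inv ≫ (v ⊗ₘ w) ≫ f = z),
        (λ_ (𝟙_ C)).inv ≫ (v ⊗ₘ ((λ_ (𝟙_ C)).inv ≫ (w ⊗ₘ u))) ≫ (α_ X Y M).inv ≫ f ▷ M =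
          (λ_ (𝟙_ C)).inv ≫ (z ⊗ₘ u) := by
      intro X Y Z v w z f h
      rw [← h, comp_tensorHom, comp_tensorHom_eq_tensorHom_whiskerRight, tensorHom_comp,
        Category.assoc, associator_inv_naturality_assoc]
      monoidal
    exact key (unitPow_concat u p q)

/-! ### Associativity and units for tensor products of multiplications. -/

variable [SymmetricCategory C]

theorem tensorMul_assoc {A B : C} {a : A ⊗ A ⟶ A} {b : B ⊗ B ⟶ B}
    (ha : a ▷ A ≫ a = (α_ A A A).hom ≫ A ◁ a ≫ a) (hb : b ▷ B ≫ b = (α_ B B B).hom ≫ B ◁ b ≫ b) :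
    tensorMul a b ▷ (A ⊗ B) ≫ tensorMul a b =
      (α_ (A ⊗ B) (A ⊗ B) (A ⊗ B)).hom ≫ (A ⊗ B) ◁ tensorMul a b ≫ tensorMul a b := by
  unfold tensorMul
  simp only [comp_whiskerRight_assoc, whiskerLeft_comp_assoc]
  slice_lhs 2 3 => rw [tensorμ_natural_left]
  slice_lhs 3 4 => rw [tensorHom_comp_tensorHom, ha, hb, ← tensorHom_comp_tensorHom,
    ← tensorHom_comp_tensorHom]
  slice_lhs 1 3 => rw [tensor_associativity]
  slice_lhs 3 4 => rw [← tensorμ_natural_right]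
  simp

theorem tensorMul_one_mul {A B : C} {a : A ⊗ A ⟶ A} {b : B ⊗ B ⟶ B} {u : 𝟙_ C ⟶ A} {w : 𝟙_ C ⟶ B}
    (ha : u ▷ A ≫ a = (λ_ A).hom) (hb : w ▷ B ≫ b = (λ_ B).hom) :
    ((λ_ (𝟙_ C)).inv ≫ (u ⊗ₘ w)) ▷ (A ⊗ B) ≫ tensorMul a b = (λ_ (A ⊗ B)).hom := by
  unfold tensorMul
  simp only [comp_whiskerRight_assoc]
  slice_lhs 2 3 => rw [tensorμ_natural_left]
  slice_lhs 3 4 => rw [tensorHom_comp_tensorHom, ha, hb]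
  symm
  exact tensor_left_unitality A B

theorem tensorMul_mul_one {A B : C} {a : A ⊗ A ⟶ A} {b : B ⊗ B ⟶ B} {u : 𝟙_ C ⟶ A} {w : 𝟙_ C ⟶ B}
    (ha : A ◁ u ≫ a = (ρ_ A).hom) (hb : B ◁ w ≫ b = (ρ_ B).hom) :
    (A ⊗ B) ◁ ((λ_ (𝟙_ C)).inv ≫ (u ⊗ₘ w)) ≫ tensorMul a b = (ρ_ (A ⊗ B)).hom := by
  unfold tensorMul
  simp only [whiskerLeft_comp_assoc]
  slice_lhs 2 3 => rw [tensorμ_natural_right]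
  slice_lhs 3 4 => rw [tensorHom_comp_tensorHom, ha, hb]
  symm
  exact tensor_right_unitality A B

variable {M : C} (m : M ⊗ M ⟶ M)

/-! ## The monoid of tensor powers -/

/-- An insertion is a composite of whiskered swaps, and under `shuffleMul_succ` each swap exchanges
two tensor factors `M` carrying the same multiplication. Associativity of `m` plays no role. -/
theorem isMulHom_insertLast : ∀ (n : ℕ) (i : Fin (n + 1)),
    IsMulHom (shuffleMul M m (n + 1)) (shuffleMul M m (n + 1)) (insertLast M n i) := by
  intro n i
  induction i using Fin.lastCases with
  | last => rw [insertLast_last]; exact IsMulHom.id _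
  | cast i =>
    cases n with
    | zero => exact i.elim0
    | succ n =>
      rw [insertLast_castSucc, shuffleMul_succ m (n + 1)]
      refine IsMulHom.comp (b := tensorMul (tensorMul (shuffleMul M m n) m) m) ?_ ?_
      · rw [shuffleMul_succ]; exact .swapLast _ _ _
      · have h := isMulHom_insertLast n i
        rw [shuffleMul_succ m n] at h
        rw [shuffleMul_succ m n]
        exact h.whiskerRight m

theorem isMulHom_permMap : ∀ {n k : ℕ} (σ : Fin n ≃ Fin k),
    IsMulHom (shuffleMul M m n) (shuffleMul M m k) (permMap M σ)
  | 0, 0, _ => by rw [permMap_zero]; exact .id _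
  | 0, _ + 1, σ => (σ.symm 0).elim0
  | _ + 1, 0, σ => (σ 0).elim0
  | n + 1, k + 1, σ => by
    rw [permMap_succ, shuffleMul_succ m n]
    refine ((isMulHom_permMap (dropLast σ)).whiskerRight m).comp ?_
    rw [← shuffleMul_succ]
    exact isMulHom_insertLast m k _

/-- Concatenation is built from a right unitor and inverse associators, all multiplicative for the
tensor products of multiplications. -/
theorem isMulHom_concat (p : ℕ) : ∀ q : ℕ,
    IsMulHom (tensorMul (shuffleMul M m p) (shuffleMul M m q)) (shuffleMul M m (p + q))
      (concat M p q)
  | 0 => by rw [shuffleMul_zero]; exact .rightUnitor _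
  | q + 1 => by
    rw [concat_succ, shuffleMul_succ m q, show shuffleMul M m (p + (q + 1)) = _ from
      shuffleMul_succ m (p + q)]
    exact (IsMulHom.associator _ _ m).inv.comp ((isMulHom_concat p q).whiskerRight m)

theorem shuffleMul_assoc (hm : m ▷ M ≫ m = (α_ M M M).hom ≫ M ◁ m ≫ m) : ∀ n : ℕ,
    shuffleMul M m n ▷ tpow M n ≫ shuffleMul M m n =
      (α_ (tpow M n) (tpow M n) (tpow M n)).hom ≫ tpow M n ◁ shuffleMul M m n ≫ shuffleMul M m n
  | 0 => by
    have key : (λ_ (𝟙_ C)).hom ▷ 𝟙_ C ≫ (λ_ (𝟙_ C)).hom =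
      (α_ (𝟙_ C) (𝟙_ C) (𝟙_ C)).hom ≫ 𝟙_ C ◁ (λ_ (𝟙_ C)).hom ≫ (λ_ (𝟙_ C)).hom := by monoidal
    rw [shuffleMul_zero]
    exact key
  | n + 1 => by
    rw [shuffleMul_succ]
    exact tensorMul_assoc (shuffleMul_assoc hm n) hm

theorem isSymSeqMonoid_tpow (hm : m ▷ M ≫ m = (α_ M M M).hom ≫ M ◁ m ≫ m) :
    IsSymSeqMonoid (fun n : FTriv => tpow M n.len) (fun σ => permMap M σ)
      (fun n => shuffleMul M m n.len) (fun p q => concat M p.len q.len) (𝟙 (𝟙_ C)) where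
  act_id n := permMap_refl M n.len
  act_comp σ τ := permMap_trans M σ τ
  γ_assoc n := shuffleMul_assoc m hm n.len
  γ_act σ := isMulHom_permMap m σ
  μ_act σ τ := concat_sumMap M σ τ
  μ_assoc p q r := concat_assoc M p.len q.len r.len
  μ_left_unit n := by
    have key : ∀ {X Y : C} {f : 𝟙_ C ⊗ X ⟶ Y} {g : Y ⟶ X} (_ : f ≫ g = (λ_ X).hom),
      𝟙 (𝟙_ C) ▷ X ≫ f ≫ g = (λ_ X).hom := by simp
    exact key (concat_zero_left M n.len)
  μ_right_unit n := by
    have key : ∀ {X : C}, X ◁ 𝟙 (𝟙_ C) ≫ (ρ_ X).hom ≫ 𝟙 X = (ρ_ X).hom := by simp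
    have e : permMap M (ρ_ n).hom = 𝟙 (tpow M n.len) := permMap_refl M n.len
    rw [e]
    exact key
  μ_γ p q := (isMulHom_concat m p.len q.len).trans (Category.assoc _ _ _)
  η_γ := by
    have key : (𝟙 (𝟙_ C) ⊗ₘ 𝟙 (𝟙_ C)) ≫ (λ_ (𝟙_ C)).hom = (λ_ (𝟙_ C)).hom ≫ 𝟙 (𝟙_ C) := by simp
    rw [show shuffleMul M m (𝟙_ FTriv).len = (λ_ (𝟙_ C)).hom from shuffleMul_zero m]
    exact key

/-! ### Units of the tensor powers. -/

variable (u : 𝟙_ C ⟶ M)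

theorem unitPow_insertLast : ∀ (n : ℕ) (i : Fin (n + 1)),
    unitPow M u (n + 1) ≫ insertLast M n i = unitPow M u (n + 1) := by
  intro n i
  induction i using Fin.lastCases with
  | last => rw [insertLast_last]; exact Category.comp_id _
  | cast i =>
    cases n with
    | zero => exact i.elim0
    | succ n =>
      have key : ∀ {X Y : C} {v : 𝟙_ C ⟶ X} {w : 𝟙_ C ⟶ Y} {f : X ⊗ M ⟶ Y}
          (_ : ((λ_ (𝟙_ C)).inv ≫ (v ⊗ₘ u)) ≫ f = w),
          ((λ_ (𝟙_ C)).inv ≫ (((λ_ (𝟙_ C)).inv ≫ (v ⊗ₘ u)) ⊗ₘ u)) ≫ swapLast X M M ≫ f ▷ M =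
            (λ_ (𝟙_ C)).inv ≫ (w ⊗ₘ u) := by
        intro X Y v w f h
        -- The braiding of the unit object with itself is trivial, so by naturality exchanging two
        -- copies of `u` changes nothing.
        have e : swapLast (𝟙_ C) (𝟙_ C) (𝟙_ C) = 𝟙 _ := by
          rw [swapLast, braiding_tensorUnit_left]
          monoidal
        have e₂ := swapLast_naturality v u u
        rw [e, Category.id_comp] at e₂
        rw [← h, comp_tensorHom, comp_tensorHom_eq_tensorHom_whiskerRight, comp_tensorHom,
          Category.assoc, Category.assoc, Category.assoc, reassoc_of% e₂]
      rw [insertLast_castSucc]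
      exact key (unitPow_insertLast n i)

theorem unitPow_permMap : ∀ {n k : ℕ} (σ : Fin n ≃ Fin k),
    unitPow M u n ≫ permMap M σ = unitPow M u k
  | 0, 0, _ => by rw [permMap_zero]; exact Category.comp_id _
  | 0, _ + 1, σ => (σ.symm 0).elim0
  | _ + 1, 0, σ => (σ 0).elim0
  | n + 1, k + 1, σ => by
    have key : ∀ {X Y Z : C} {v : 𝟙_ C ⟶ X} {w : 𝟙_ C ⟶ Y} {z : 𝟙_ C ⟶ Z} {f : X ⟶ Y}
        {g : Y ⊗ M ⟶ Z} (_ : v ≫ f = w) (_ : ((λ_ (𝟙_ C)).inv ≫ (w ⊗ₘ u)) ≫ g = z),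
        ((λ_ (𝟙_ C)).inv ≫ (v ⊗ₘ u)) ≫ f ▷ M ≫ g = z := by
      intro X Y Z v w z f g h h'
      rw [← h', ← h, comp_tensorHom_eq_tensorHom_whiskerRight]
      simp only [Category.assoc]
    rw [permMap_succ]
    exact key (unitPow_permMap (dropLast σ)) (unitPow_insertLast u k _)

theorem isUnitalSymSeqMonoid_tpow (hm : m ▷ M ≫ m = (α_ M M M).hom ≫ M ◁ m ≫ m)
    (hl : u ▷ M ≫ m = (λ_ M).hom) (hr : M ◁ u ≫ m = (ρ_ M).hom) :
    IsUnitalSymSeqMonoid (fun n : FTriv => tpow M n.len) (fun σ => permMap M σ)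
      (fun n => shuffleMul M m n.len) (fun p q => concat M p.len q.len) (𝟙 (𝟙_ C))
      (fun n => unitPow M u n.len) where
  toIsSymSeqMonoid := isSymSeqMonoid_tpow m hm
  u_mul n := by
    induction n.len with
    | zero =>
      rw [shuffleMul_zero]
      have key : 𝟙 (𝟙_ C) ▷ 𝟙_ C ≫ (λ_ (𝟙_ C)).hom = (λ_ (𝟙_ C)).hom := by simp
      exact key
    | succ n ih =>
      rw [shuffleMul_succ]
      exact tensorMul_one_mul ih hl
  mul_u n := by
    induction n.len with
    | zero =>
      rw [shuffleMul_zero]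
      have key : 𝟙_ C ◁ 𝟙 (𝟙_ C) ≫ (λ_ (𝟙_ C)).hom = (ρ_ (𝟙_ C)).hom := by simp [unitors_equal]
      exact key
    | succ n ih =>
      rw [shuffleMul_succ]
      exact tensorMul_mul_one ih hr
  u_act σ := unitPow_permMap u σ
  u_μ p q := unitPow_concat u p.len q.len
  u_η := rfl

end

/-! ## The universal property of a presented symmetric monoidal category -/

section

universe v₁ u₁

variable {X : Type u} {C : Type u₁} [Category.{v₁} C] [MonoidalCategory C]

/-- The object represented by a word, given the values of the letters. -/
def Word.eval (o : X → C) : Word X → C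
  | .of x => o x
  | .unit => 𝟙_ C
  | .tensor a b => Word.eval o a ⊗ Word.eval o b

variable [SymmetricCategory C] {G : Word X → Word X → Type w} {o : X → C}

/-- The morphism represented by a formal morphism, given the values of the generators. -/
def PreHom.eval (t : ∀ {a b : Word X}, G a b → (a.eval o ⟶ b.eval o)) :
    ∀ {a b : Word X}, PreHom G a b → (a.eval o ⟶ b.eval o)
  | _, _, gen g => t g
  | _, _, id a => 𝟙 (a.eval o)
  | _, _, comp f g => PreHom.eval t f ≫ PreHom.eval t g
  | _, _, tensor f g => PreHom.eval t f ⊗ₘ PreHom.eval t g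
  | _, _, assoc a b c => (α_ (a.eval o) (b.eval o) (c.eval o)).hom
  | _, _, assocInv a b c => (α_ (a.eval o) (b.eval o) (c.eval o)).inv
  | _, _, lunit a => (λ_ (a.eval o)).hom
  | _, _, lunitInv a => (λ_ (a.eval o)).inv
  | _, _, runit a => (ρ_ (a.eval o)).hom
  | _, _, runitInv a => (ρ_ (a.eval o)).inv
  | _, _, braid a b => (β_ (a.eval o) (b.eval o)).hom

theorem PreHom.eval_map {G' : Word X → Word X → Type w} (s : ∀ {a b : Word X}, G a b → G' a b)
    (t : ∀ {a b : Word X}, G' a b → (a.eval o ⟶ b.eval o)) {a b : Word X} (f : PreHom G a b) :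
    (f.map s).eval t = f.eval (fun g => t (s g)) := by
  induction f with
  | comp f g ihf ihg => exact congrArg₂ (· ≫ ·) ihf ihg
  | tensor f g ihf ihg => exact congrArg₂ (· ⊗ₘ ·) ihf ihg
  | _ => rfl

variable {R : ∀ {a b : Word X}, PreHom G a b → PreHom G a b → Prop}

/-- Besides `R`, the congruence imposes only axioms that hold in every symmetric monoidal category,
so soundness has to be checked on `R` alone. -/
theorem WordRel.eval_eq (t : ∀ {a b : Word X}, G a b → (a.eval o ⟶ b.eval o))
    (ht : ∀ {a b : Word X} {f g : PreHom G a b}, R f g → f.eval t = g.eval t)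
    {a b : Word X} {f g : PreHom G a b} (h : WordRel R f g) : f.eval t = g.eval t := by
  induction h with
  | rel h => exact ht h
  | refl f => rfl
  | symm _ ih => exact ih.symm
  | trans _ _ ih₁ ih₂ => exact ih₁.trans ih₂
  | comp _ _ ih₁ ih₂ => exact congrArg₂ (· ≫ ·) ih₁ ih₂
  | tensor _ _ ih₁ ih₂ => exact congrArg₂ (· ⊗ₘ ·) ih₁ ih₂
  | id_comp f => exact Category.id_comp _
  | comp_id f => exact Category.comp_id _
  | comp_assoc f g h => exact Category.assoc _ _ _
  | tensor_id a b => exact id_tensorHom_id _ _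
  | tensor_comp f₁ f₂ g₁ g₂ => exact tensorHom_comp_tensorHom _ _ _ _
  | assoc_inv a b c => exact Iso.hom_inv_id _
  | inv_assoc a b c => exact Iso.inv_hom_id _
  | assoc_nat f₁ f₂ f₃ => exact associator_naturality _ _ _
  | lunit_inv a => exact Iso.hom_inv_id _
  | inv_lunit a => exact Iso.inv_hom_id _
  | lunit_nat f =>
    refine (congrArg (· ≫ _) (id_tensorHom _ _)).trans ?_
    exact leftUnitor_naturality _
  | runit_inv a => exact Iso.hom_inv_id _
  | inv_runit a => exact Iso.inv_hom_id _
  | runit_nat f =>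
    refine (congrArg (· ≫ _) (tensorHom_id _ _)).trans ?_
    exact rightUnitor_naturality _
  | pentagon a b c d =>
    have key : ∀ a b c d : C, ((α_ a b c).hom ⊗ₘ 𝟙 d) ≫ (α_ a (b ⊗ c) d).hom ≫
        (𝟙 a ⊗ₘ (α_ b c d).hom) = (α_ (a ⊗ b) c d).hom ≫ (α_ a b (c ⊗ d)).hom := by simp
    exact key _ _ _ _
  | triangle a b =>
    have key : ∀ a b : C, (α_ a (𝟙_ C) b).hom ≫ (𝟙 a ⊗ₘ (λ_ b).hom) = (ρ_ a).hom ⊗ₘ 𝟙 b := by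
      simp
    exact key _ _
  | braid_nat f g => exact BraidedCategory.braiding_naturality _ _
  | braid_braid a b => exact SymmetricCategory.symmetry _ _
  | hexagon a b c =>
    have key : ∀ a b c : C, (α_ a b c).hom ≫ (β_ a (b ⊗ c)).hom ≫ (α_ b c a).hom =
        ((β_ a b).hom ⊗ₘ 𝟙 c) ≫ (α_ b a c).hom ≫ (𝟙 b ⊗ₘ (β_ a c).hom) := by simp
    exact key _ _ _
  | hexagon_inv a b c =>
    have key : ∀ a b c : C, (α_ a b c).inv ≫ (β_ (a ⊗ b) c).hom ≫ (α_ c a b).inv =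
        (𝟙 a ⊗ₘ (β_ b c).hom) ≫ (α_ a c b).inv ≫ ((β_ a c).hom ⊗ₘ 𝟙 b) := by simp
    exact key _ _ _

/-! ### The symmetric monoidal functor determined by values on generators. -/

namespace Presented

/-- The functor out of a presented symmetric monoidal category determined by the values of the
generators. -/
def lift (t : ∀ {a b : Word X}, G a b → (a.eval o ⟶ b.eval o))
    (ht : ∀ {a b : Word X} {f g : PreHom G a b}, R f g → f.eval t = g.eval t) :
    Presented R ⥤ C where
  obj a := Word.eval o a
  map f := Quot.lift (fun f => f.eval t) (fun _ _ h => h.eval_eq t ht) f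
  map_id _ := rfl
  map_comp := by
    rintro _ _ _ ⟨f⟩ ⟨g⟩
    rfl

variable (t : ∀ {a b : Word X}, G a b → (a.eval o ⟶ b.eval o))
    (ht : ∀ {a b : Word X} {f g : PreHom G a b}, R f g → f.eval t = g.eval t)

instance : (lift (R := R) t ht).Monoidal :=
  Functor.CoreMonoidal.toMonoidal
    { εIso := Iso.refl _
      μIso := fun a b => Iso.refl (Word.eval o a ⊗ Word.eval o b)
      μIso_hom_natural_left := by
        rintro a b ⟨f⟩ c
        have key : ∀ {A B D : C} (f : A ⟶ B), f ▷ D ≫ 𝟙 (B ⊗ D) = 𝟙 (A ⊗ D) ≫ (f ⊗ₘ 𝟙 D) := by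
          simp
        exact key (f.eval t)
      μIso_hom_natural_right := by
        rintro a b c ⟨f⟩
        have key : ∀ {A B D : C} (f : A ⟶ B), D ◁ f ≫ 𝟙 (D ⊗ B) = 𝟙 (D ⊗ A) ≫ (𝟙 D ⊗ₘ f) := by
          simp
        exact key (f.eval t)
      associativity := by
        intro a b c
        have key : ∀ a b c : C, 𝟙 (a ⊗ b) ▷ c ≫ 𝟙 ((a ⊗ b) ⊗ c) ≫ (α_ a b c).hom =
            (α_ a b c).hom ≫ a ◁ 𝟙 (b ⊗ c) ≫ 𝟙 (a ⊗ (b ⊗ c)) := by simp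
        exact key _ _ _
      left_unitality := by
        intro a
        have key : ∀ a : C, (λ_ a).hom = 𝟙 (𝟙_ C) ▷ a ≫ 𝟙 (𝟙_ C ⊗ a) ≫ (λ_ a).hom := by simp
        exact key _
      right_unitality := by
        intro a
        have key : ∀ a : C, (ρ_ a).hom = a ◁ 𝟙 (𝟙_ C) ≫ 𝟙 (a ⊗ 𝟙_ C) ≫ (ρ_ a).hom := by simp
        exact key _ }

instance : (lift (R := R) t ht).Braided where
  braided a b :=
    have key : ∀ a b : C, 𝟙 (a ⊗ b) ≫ (β_ a b).hom = (β_ a b).hom ≫ 𝟙 (b ⊗ a) := by simp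
    key _ _

end Presented

end

/-! ## The op of tensor powers -/

section

variable {C : Type u} [Category.{v} C] [MonoidalCategory C] [SymmetricCategory C]

/-- The value of the op of tensor powers on a letter. -/
def opObj (M : C) (φ : Arrow FTriv) : C := tpow M φ.left.len

/-- The action of `γ` on tensor powers. -/
def opγ {M : C} (m : M ⊗ M ⟶ M) {a b : FTriv} (φ : a ⟶ b) :
    tpow M b.len ⊗ tpow M a.len ⟶ tpow M a.len :=
  permMap M (Equiv.symm φ) ▷ tpow M a.len ≫ shuffleMul M m a.len

/-- The values of the op of tensor powers on the generators of the nc-plus construction. -/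
def opNCGen {M : C} (m : M ⊗ M ⟶ M) :
    ∀ {a b : Word (Arrow FTriv)}, NCGen FTriv a b → (a.eval (opObj M) ⟶ b.eval (opObj M))
  | _, _, .iso σ _ _ => permMap M σ.hom
  | _, _, .γ _ φ₀ => opγ m φ₀
  | _, _, .μ (a := a) (c := c) _ _ => concat M a.len c.len
  | _, _, .ε => 𝟙 (𝟙_ C)

/-- The inverse of concatenation. -/
noncomputable def concatInv (M : C) (p q : ℕ) : tpow M (p + q) ⟶ tpow M p ⊗ tpow M q :=
  inv (concat M p q)

/-- The values of the op of tensor powers on the generators of the plus construction. -/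
noncomputable def opPlusGen {M : C} (m : M ⊗ M ⟶ M) :
    ∀ {a b : Word (Arrow FTriv)}, PlusGen FTriv a b → (a.eval (opObj M) ⟶ b.eval (opObj M))
  | _, _, .nc g => opNCGen m g
  | _, _, .μInv (a := a) (c := c) _ _ => concatInv M a.len c.len
  | _, _, .εInv => 𝟙 (𝟙_ C)

variable {M : C} {m : M ⊗ M ⟶ M}

/-- The value of `γ` depends only on the inner morphism, along whose inverse the outer tensor power
is carried back. Associativity then combines that of the shuffled multiplication, multiplicativity
of the action of the inverse of `φ₀`, and its functoriality. -/
theorem opγ_assoc (hm : m ▷ M ≫ m = (α_ M M M).hom ≫ M ◁ m ≫ m) {a b c : FTriv}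
    (φ₁ : b ⟶ c) (φ₀ : a ⟶ b) :
    opγ m φ₁ ▷ tpow M a.len ≫ opγ m φ₀ =
      (α_ (tpow M c.len) (tpow M b.len) (tpow M a.len)).hom ≫
        tpow M c.len ◁ opγ m φ₀ ≫ opγ m (φ₀ ≫ φ₁) := by
  have key : ∀ {A B D : C} {a : A ⊗ A ⟶ A} {b : B ⊗ B ⟶ B} {f : D ⟶ B} {g : B ⟶ A} {h : D ⟶ A}
      (_ : a ▷ A ≫ a = (α_ A A A).hom ≫ A ◁ a ≫ a) (_ : IsMulHom b a g) (_ : f ≫ g = h),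
      (f ▷ B ≫ b) ▷ A ≫ g ▷ A ≫ a = (α_ D B A).hom ≫ D ◁ (g ▷ A ≫ a) ≫ h ▷ A ≫ a := by
    intro A B D a b f g h ha hg hh
    rw [← hh, ← comp_whiskerRight_assoc, Category.assoc, ← hg, comp_whiskerRight_assoc,
      comp_whiskerRight_assoc, ha]
    rw [whiskerLeft_comp, Category.assoc, whisker_exchange_assoc, MonoidalCategory.tensorHom_def,
      comp_whiskerRight, Category.assoc, whisker_exchange_assoc]
    simp
  refine key (shuffleMul_assoc m hm a.len) (isMulHom_permMap m _) ?_
  rw [← permMap_trans]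
  rfl

theorem opγ_equiv {a b a' b' : FTriv} {φ : a ⟶ b} {φ' : a' ⟶ b'} (σ : a ≅ a') (τ : b ≅ b')
    (h : φ ≫ τ.hom = σ.hom ≫ φ') :
    (permMap M τ.hom ⊗ₘ permMap M σ.hom) ≫ opγ m φ' = opγ m φ ≫ permMap M σ.hom := by
  -- The naturality square `h` with both vertical bijections inverted.
  have h' : τ.hom.trans (Equiv.symm φ') = Equiv.trans (Equiv.symm φ) σ.hom := by
    have h₁ : Equiv.trans φ τ.hom = Equiv.trans σ.hom φ' := h
    ext i
    obtain ⟨j, rfl⟩ := Equiv.surjective φ i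
    have := DFunLike.congr_fun h₁ j
    simp only [Equiv.trans_apply] at this ⊢
    rw [this]
    simp
  have e := isMulHom_permMap m σ.hom
  unfold IsMulHom at e
  rw [opγ, opγ, Category.assoc, ← e, ← Category.assoc, ← Category.assoc, ← comp_tensorHom,
    ← comp_tensorHom_eq_tensorHom_whiskerRight, ← permMap_trans, ← permMap_trans, h']

/-- Concatenation is multiplicative and commutes with juxtaposed permutations; the inverse of a
juxtaposition is the juxtaposition of the inverses. -/
theorem opγ_interchange {a b a' b' : FTriv} (φ : a ⟶ b) (ψ : a' ⟶ b') :
    (concat M b.len b'.len ⊗ₘ concat M a.len a'.len) ≫ opγ m (φ ⊗ₘ ψ) =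
      tensorμ _ _ _ _ ≫ (opγ m φ ⊗ₘ opγ m ψ) ≫ concat M a.len a'.len := by
  have key : ∀ {A A' B B' D E : C} {a : A ⊗ A ⟶ A} {a' : A' ⊗ A' ⟶ A'} {d : D ⊗ D ⟶ D}
      {f : A ⊗ A' ⟶ D} {g : B ⊗ B' ⟶ E} {h : B ⟶ A} {h' : B' ⟶ A'} {k : E ⟶ D}
      (_ : IsMulHom (tensorMul a a') d f) (_ : (h ⊗ₘ h') ≫ f = g ≫ k),
      (g ⊗ₘ f) ≫ k ▷ D ≫ d = tensorμ B B' A A' ≫ ((h ▷ A ≫ a) ⊗ₘ (h' ▷ A' ≫ a')) ≫ f := by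
    intro A A' B B' D E a a' d f g h h' k e₁ e₂
    unfold IsMulHom tensorMul at e₁
    rw [← Category.assoc, ← comp_tensorHom_eq_tensorHom_whiskerRight, ← e₂, comp_tensorHom,
      Category.assoc, e₁, ← tensorHom_comp_tensorHom]
    simp only [Category.assoc]
    rw [tensorμ_natural_left_assoc]
  have e : Equiv.symm (φ ⊗ₘ ψ) = FTriv.sumMap (Equiv.symm φ) (Equiv.symm ψ) := rfl
  rw [opγ, e]
  exact key (isMulHom_concat m a.len a'.len) (concat_sumMap M _ _)

/-- Each relation is a law of tensor powers. The isomorphisms `(id ⇓ id)`, which only change the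
expression of a morphism, act through identity permutations and disappear. -/
theorem opNCGen_rel (hm : m ▷ M ≫ m = (α_ M M M).hom ≫ M ◁ m ≫ m)
    {a b : Word (Arrow FTriv)} {f g : PreHom (NCGen FTriv) a b} (h : NCRel FTriv f g) :
    f.eval (opNCGen m) = g.eval (opNCGen m) := by
  induction h with
  | iso_id φ => exact permMap_refl M _
  | iso_comp σ σ' h τ τ' k => exact (permMap_trans M _ _).symm
  | γ_assoc φ₂ φ₁ φ₀ =>
    have key : ∀ {A B D : C} {f : D ⊗ B ⟶ B} {g : B ⊗ A ⟶ A} {h : D ⊗ A ⟶ A} {i : A ⟶ A}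
        (_ : f ▷ A ≫ g = (α_ D B A).hom ≫ D ◁ g ≫ h) (_ : i = 𝟙 A),
        (f ⊗ₘ 𝟙 A) ≫ g = (α_ D B A).hom ≫ (𝟙 D ⊗ₘ g) ≫ h ≫ i := by
      intro A B D f g h i e₁ e₂
      simp [e₁, e₂]
    exact key (opγ_assoc hm φ₁ φ₀) (permMap_refl M _)
  | γ_equiv σ τ ρ h₀ h₁ => exact opγ_equiv σ τ h₀
  | @μ_assoc a b c d e f φ ψ χ =>
    have h := (isSymSeqMonoid_tpow m hm).μ_assoc a c e
    rw [← tensorHom_id, ← id_tensorHom] at h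
    exact h
  | @μ_left_unit a b φ =>
    have h := (isSymSeqMonoid_tpow m hm).μ_left_unit a
    exact (congrArg (· ≫ _) (tensorHom_id (𝟙 (𝟙_ C)) (tpow M a.len))).trans h
  | @μ_right_unit a b φ =>
    have h := (isSymSeqMonoid_tpow m hm).μ_right_unit a
    exact (congrArg (· ≫ _) (id_tensorHom (tpow M a.len) (𝟙 (𝟙_ C)))).trans h
  | μ_comm φ ψ => exact concat_finAddFlip M _ _
  | μ_equiv σ σ' h τ τ' k => exact concat_sumMap M σ.hom τ.hom
  | interchange φ₁ φ₀ ψ₁ ψ₀ =>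
    have key : ∀ {A A' B B' D E : C} {f : A ⊗ A' ⟶ D} {g : B ⊗ B' ⟶ E} {c : E ⊗ D ⟶ D}
        {h : B ⊗ A ⟶ A} {h' : B' ⊗ A' ⟶ A'} {i : D ⟶ D}
        (_ : (g ⊗ₘ f) ≫ c = tensorμ B B' A A' ≫ (h ⊗ₘ h') ≫ f) (_ : i = 𝟙 D),
        (g ⊗ₘ f) ≫ c ≫ i = ((α_ B B' (A ⊗ A')).hom ≫
          (𝟙 B ⊗ₘ ((α_ B' A A').inv ≫ ((β_ B' A).hom ⊗ₘ 𝟙 A') ≫ (α_ A B' A').hom)) ≫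
            (α_ B A (B' ⊗ A')).inv) ≫ (h ⊗ₘ h') ≫ f := by
      intro A A' B B' D E f g c h h' i e₁ e₂
      rw [e₂, Category.comp_id, e₁, tensorμ]
      simp only [id_tensorHom, tensorHom_id, whiskerLeft_comp, Category.assoc]
    exact key (opγ_interchange φ₀ ψ₀) (permMap_refl M _)
  | interchange_unit =>
    have key : ∀ {i j : 𝟙_ C ⟶ 𝟙_ C} {s : 𝟙_ C ⊗ 𝟙_ C ⟶ 𝟙_ C} (_ : i = 𝟙 _) (_ : j = 𝟙 _)
        (_ : s = (λ_ (𝟙_ C)).hom), (𝟙 (𝟙_ C) ⊗ₘ 𝟙 (𝟙_ C)) ≫ (j ▷ 𝟙_ C ≫ s) ≫ i =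
          (λ_ (𝟙_ C)).hom ≫ 𝟙 (𝟙_ C) := by
      rintro _ _ _ rfl rfl rfl
      simp
    exact key (permMap_refl M 0) (permMap_refl M 0) (shuffleMul_zero m)

theorem opPlusGen_rel (hm : m ▷ M ≫ m = (α_ M M M).hom ≫ M ◁ m ≫ m)
    {a b : Word (Arrow FTriv)} {f g : PreHom (PlusGen FTriv) a b} (h : PlusRel FTriv f g) :
    f.eval (opPlusGen m) = g.eval (opPlusGen m) := by
  induction h with
  | nc h =>
    rw [PreHom.eval_map, PreHom.eval_map]
    exact opNCGen_rel hm h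
  | μ_μInv φ ψ => exact IsIso.hom_inv_id (concat M _ _)
  | μInv_μ φ ψ => exact IsIso.inv_hom_id (concat M _ _)
  | ε_εInv => exact Category.id_comp _
  | εInv_ε => exact Category.id_comp _

theorem shuffleMul_one_leftUnitor (m : M ⊗ M ⟶ M) :
    IsMulHom (shuffleMul M m 1) m (λ_ M).hom := by
  rw [show shuffleMul M m 1 = tensorMul (shuffleMul M m 0) m from shuffleMul_succ m 0,
    shuffleMul_zero]
  exact .leftUnitor m

theorem exists_op (hm : m ▷ M ≫ m = (α_ M M M).hom ≫ M ◁ m ≫ m) :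
    ∃ (P : Plus FTriv ⥤ C) (_ : P.Braided) (e : P.obj FTriv.star ≅ M),
      Functor.LaxMonoidal.μ P FTriv.star FTriv.star ≫ P.map FTriv.starMul ≫ e.hom =
        (e.hom ⊗ₘ e.hom) ≫ m := by
  -- The recursion starts at the unit object, so `tpow M 1` is `𝟙_ C ⊗ M` and the identification
  -- with `M` is the left unitor.
  refine ⟨Presented.lift (opPlusGen m) (opPlusGen_rel hm), inferInstance, λ_ M, ?_⟩
  have key : ∀ {A : C} {e : A ⟶ M} {i j : A ⟶ A} {s : A ⊗ A ⟶ A} (_ : i = 𝟙 A) (_ : j = 𝟙 A)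
      (_ : IsMulHom s m e), 𝟙 (A ⊗ A) ≫ ((j ▷ A ≫ s) ≫ i) ≫ e = (e ⊗ₘ e) ≫ m := by
    rintro A e _ _ s rfl rfl h
    rw [h]
    simp
  exact key (permMap_refl M 1) (permMap_refl M 1) (shuffleMul_one_leftUnitor m)

end

/-! ## Calculus in the nc-plus construction -/

section

variable {M : Type u} [Category.{v} M] [MonoidalCategory M] [SymmetricCategory M]

/-- A morphism of `M` as an object of the nc-plus construction. -/
def ncLetter {a b : M} (φ : a ⟶ b) : NCPlus M := letter φ

/-- The morphism `(σ ⇓ σ')` of the nc-plus construction. -/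
def ncIso {a b a' b' : M} {φ : a ⟶ b} {ψ : a' ⟶ b'} (σ : a ≅ a') (σ' : b ≅ b')
    (h : φ ≫ σ'.hom = σ.hom ≫ ψ) : ncLetter φ ⟶ ncLetter ψ :=
  Presented.homMk (NCGen.isoP σ σ' h)

/-- The morphism `γ` of the nc-plus construction. -/
def ncGamma {a b c : M} (φ₁ : b ⟶ c) (φ₀ : a ⟶ b) :
    ncLetter φ₁ ⊗ ncLetter φ₀ ⟶ ncLetter (φ₀ ≫ φ₁) :=
  Presented.homMk (NCGen.γP φ₁ φ₀)

/-- The morphism `μ` of the nc-plus construction. -/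
def ncMu {a b c d : M} (φ : a ⟶ b) (ψ : c ⟶ d) :
    ncLetter φ ⊗ ncLetter ψ ⟶ ncLetter (φ ⊗ₘ ψ) :=
  Presented.homMk (NCGen.μP φ ψ)

/-- The morphism `ε` of the nc-plus construction. -/
def ncEps : 𝟙_ (NCPlus M) ⟶ ncLetter (𝟙 (𝟙_ M)) :=
  Presented.homMk NCGen.εP

theorem ncIso_congr {a b a' b' : M} {φ : a ⟶ b} {ψ : a' ⟶ b'} {σ τ : a ≅ a'} {σ' τ' : b ≅ b'}
    {h : φ ≫ σ'.hom = σ.hom ≫ ψ} {h' : φ ≫ τ'.hom = τ.hom ≫ ψ} (e : σ.hom = τ.hom)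
    (e' : σ'.hom = τ'.hom) : ncIso σ σ' h = ncIso τ τ' h' := by
  obtain rfl := Iso.ext e
  obtain rfl := Iso.ext e'
  rfl

theorem ncIso_refl {a b : M} (φ : a ⟶ b)
    (h : φ ≫ (Iso.refl b).hom = (Iso.refl a).hom ≫ φ := by simp) :
    ncIso (Iso.refl a) (Iso.refl b) h = 𝟙 (ncLetter φ) :=
  Quot.sound (.rel (.iso_id φ))

theorem ncIso_comp {a b a' b' a'' b'' : M} {φ : a ⟶ b} {φ' : a' ⟶ b'} {φ'' : a'' ⟶ b''}
    (σ : a ≅ a') (σ' : b ≅ b') (h : φ ≫ σ'.hom = σ.hom ≫ φ')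
    (τ : a' ≅ a'') (τ' : b' ≅ b'') (k : φ' ≫ τ'.hom = τ.hom ≫ φ'') :
    ncIso σ σ' h ≫ ncIso τ τ' k =
      ncIso (σ ≪≫ τ) (σ' ≪≫ τ') (by simp [← k, reassoc_of% h]) :=
  Quot.sound (.rel (.iso_comp σ σ' h τ τ' k))

theorem ncGamma_equiv {a b c a' b' c' : M} {φ₁ : b ⟶ c} {φ₀ : a ⟶ b} {φ₁' : b' ⟶ c'}
    {φ₀' : a' ⟶ b'} (σ : a ≅ a') (τ : b ≅ b') (ρ : c ≅ c')
    (h₀ : φ₀ ≫ τ.hom = σ.hom ≫ φ₀') (h₁ : φ₁ ≫ ρ.hom = τ.hom ≫ φ₁') :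
    (ncIso τ ρ h₁ ⊗ₘ ncIso σ τ h₀) ≫ ncGamma φ₁' φ₀' =
      ncGamma φ₁ φ₀ ≫ ncIso σ ρ (by simp [h₁, reassoc_of% h₀]) :=
  Quot.sound (.rel (.γ_equiv σ τ ρ h₀ h₁))

theorem ncMu_equiv {a b a' b' c d c' d' : M} {φ : a ⟶ b} {φ' : a' ⟶ b'} {ψ : c ⟶ d}
    {ψ' : c' ⟶ d'} (σ : a ≅ a') (σ' : b ≅ b') (h : φ ≫ σ'.hom = σ.hom ≫ φ')
    (τ : c ≅ c') (τ' : d ≅ d') (k : ψ ≫ τ'.hom = τ.hom ≫ ψ') :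
    (ncIso σ σ' h ⊗ₘ ncIso τ τ' k) ≫ ncMu φ' ψ' =
      ncMu φ ψ ≫ ncIso (σ ⊗ᵢ τ) (σ' ⊗ᵢ τ') (by simp [tensorHom_comp_tensorHom, h, k]) :=
  Quot.sound (.rel (.μ_equiv σ σ' h τ τ' k))

theorem ncMu_assoc {a b c d e f : M} (φ : a ⟶ b) (ψ : c ⟶ d) (χ : e ⟶ f) :
    ncMu φ ψ ▷ ncLetter χ ≫ ncMu (φ ⊗ₘ ψ) χ ≫
        ncIso (ψ := φ ⊗ₘ (ψ ⊗ₘ χ)) (α_ a c e) (α_ b d f) (by simp) =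
      (α_ (ncLetter φ) (ncLetter ψ) (ncLetter χ)).hom ≫ ncLetter φ ◁ ncMu ψ χ ≫
        ncMu φ (ψ ⊗ₘ χ) :=
  Quot.sound (.rel (.μ_assoc φ ψ χ))

theorem ncMu_left_unit {a b : M} (φ : a ⟶ b) :
    ncEps ▷ ncLetter φ ≫ ncMu (𝟙 (𝟙_ M)) φ ≫ ncIso (ψ := φ) (λ_ a) (λ_ b) (by simp) =
      (λ_ (ncLetter φ)).hom :=
  Quot.sound (.rel (.μ_left_unit φ))

theorem ncMu_right_unit {a b : M} (φ : a ⟶ b) :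
    ncLetter φ ◁ ncEps ≫ ncMu φ (𝟙 (𝟙_ M)) ≫ ncIso (ψ := φ) (ρ_ a) (ρ_ b) (by simp) =
      (ρ_ (ncLetter φ)).hom :=
  Quot.sound (.rel (.μ_right_unit φ))

theorem ncMu_comm {a b c d : M} (φ : a ⟶ b) (ψ : c ⟶ d) :
    ncMu φ ψ ≫ ncIso (ψ := ψ ⊗ₘ φ) (β_ a c) (β_ b d) (by simp) =
      (β_ (ncLetter φ) (ncLetter ψ)).hom ≫ ncMu ψ φ :=
  Quot.sound (.rel (.μ_comm φ ψ))

theorem nc_interchange {a b c a' b' c' : M} (φ₁ : b ⟶ c) (φ₀ : a ⟶ b) (ψ₁ : b' ⟶ c')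
    (ψ₀ : a' ⟶ b') :
    (ncMu φ₁ ψ₁ ⊗ₘ ncMu φ₀ ψ₀) ≫ ncGamma (φ₁ ⊗ₘ ψ₁) (φ₀ ⊗ₘ ψ₀) ≫
        ncIso (Iso.refl _) (Iso.refl _) (by simp) =
      tensorμ _ _ _ _ ≫ (ncGamma φ₁ φ₀ ⊗ₘ ncGamma ψ₁ ψ₀) ≫ ncMu (φ₀ ≫ φ₁) (ψ₀ ≫ ψ₁) := by
  -- The relation uses the formal `exchange`; it is spelled out here so that it can be recognised as
  -- `tensorμ`.
  have h : (ncMu φ₁ ψ₁ ⊗ₘ ncMu φ₀ ψ₀) ≫ ncGamma (φ₁ ⊗ₘ ψ₁) (φ₀ ⊗ₘ ψ₀) ≫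
        ncIso (Iso.refl _) (Iso.refl _) (by simp) =
      ((α_ _ _ _).hom ≫ (𝟙 _ ⊗ₘ ((α_ _ _ _).inv ≫ ((β_ _ _).hom ⊗ₘ 𝟙 _) ≫ (α_ _ _ _).hom)) ≫
        (α_ _ _ _).inv) ≫ (ncGamma φ₁ φ₀ ⊗ₘ ncGamma ψ₁ ψ₀) ≫ ncMu (φ₀ ≫ φ₁) (ψ₀ ≫ ψ₁) :=
    Quot.sound (.rel (.interchange φ₁ φ₀ ψ₁ ψ₀))
  rw [h, tensorμ]
  simp only [id_tensorHom, tensorHom_id, whiskerLeft_comp, Category.assoc]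

theorem nc_interchange_unit :
    (ncEps ⊗ₘ ncEps) ≫ ncGamma (𝟙 (𝟙_ M)) (𝟙 (𝟙_ M)) ≫
        ncIso (Iso.refl _) (Iso.refl _) (by simp) =
      (λ_ (𝟙_ (NCPlus M))).hom ≫ ncEps :=
  Quot.sound (.rel .interchange_unit)

instance isIso_ncIso {a b a' b' : M} {φ : a ⟶ b} {ψ : a' ⟶ b'} (σ : a ≅ a') (σ' : b ≅ b')
    (h : φ ≫ σ'.hom = σ.hom ≫ ψ) : IsIso (ncIso σ σ' h) := by
  have k : ψ ≫ σ'.symm.hom = σ.symm.hom ≫ φ := by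
    simp [Iso.comp_inv_eq, h]
  refine ⟨ncIso σ.symm σ'.symm k, ?_, ?_⟩
  · rw [ncIso_comp, ← ncIso_refl]
    exact ncIso_congr (by simp) (by simp)
  · rw [ncIso_comp, ← ncIso_refl]
    exact ncIso_congr (by simp) (by simp)

instance isIso_plusQuotient_ncMu {a b c d : M} (φ : a ⟶ b) (ψ : c ⟶ d) :
    IsIso ((plusQuotient M).map (ncMu φ ψ)) :=
  ⟨Presented.homMk (PreHom.gen (.μInv φ ψ)), Quot.sound (.rel (.μ_μInv φ ψ)),
    Quot.sound (.rel (.μInv_μ φ ψ))⟩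

instance isIso_plusQuotient_ncEps : IsIso ((plusQuotient M).map (ncEps (M := M))) :=
  ⟨Presented.homMk (PreHom.gen .εInv), Quot.sound (.rel .ε_εInv),
    Quot.sound (.rel .εInv_ε)⟩

end

/-! ## The basic objects as a lax braided functor -/

namespace FTriv

/-- The functor `n ↦ id_{∗^n}` from the trivial Feynman category to its nc-plus construction. -/
def basicFunctor : FTriv ⥤ NCPlus FTriv where
  obj := basic
  map σ := ncAct σ
  map_id n := ncIso_refl (𝟙 n)
  map_comp σ τ :=
    ((ncIso_comp (ofEquiv σ) (ofEquiv σ) (by simp) (ofEquiv τ) (ofEquiv τ) (by simp)).trans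
      (ncIso_congr rfl rfl)).symm

theorem ncμ_act {p q p' q' : FTriv} (σ : p ⟶ p') (τ : q ⟶ q') :
    (ncAct σ ⊗ₘ ncAct τ) ≫ ncμ p' q' = ncμ p q ≫ ncAct (σ ⊗ₘ τ) := by
  have h : ((ncIso (φ := 𝟙 p) (ψ := 𝟙 p') (ofEquiv σ) (ofEquiv σ) (by simp)) ⊗ₘ
      (ncIso (φ := 𝟙 q) (ψ := 𝟙 q') (ofEquiv τ) (ofEquiv τ) (by simp))) ≫
      ncMu (𝟙 p') (𝟙 q') ≫ ncIso (ψ := 𝟙 (p' ⊗ q')) (Iso.refl _) (Iso.refl _) (by simp) =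
      (ncMu (𝟙 p) (𝟙 q) ≫ ncIso (ψ := 𝟙 (p ⊗ q)) (Iso.refl _) (Iso.refl _) (by simp)) ≫
      ncIso (φ := 𝟙 (p ⊗ q)) (ψ := 𝟙 (p' ⊗ q')) (ofEquiv (σ ⊗ₘ τ)) (ofEquiv (σ ⊗ₘ τ))
        (by simp) := by
    rw [← Category.assoc, ncMu_equiv, Category.assoc, Category.assoc, ncIso_comp, ncIso_comp]
    exact congrArg _ (ncIso_congr rfl rfl)
  exact h

/-- Associativity of the generator `μ` lands in tensor products of identities, while basic objects
are identities of tensor products. The correcting isomorphisms `(id ⇓ id)` are slid past `μ` by its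
equivariance (`e₁`, `e₂`) and then composed. -/
theorem ncμ_assoc (p q r : FTriv) :
    ncμ p q ▷ basic r ≫ ncμ (p ⊗ q) r ≫ ncAct (α_ p q r).hom =
      (α_ (basic p) (basic q) (basic r)).hom ≫ basic p ◁ ncμ q r ≫ ncμ p (q ⊗ r) := by
  have e₁ := ncMu_equiv (φ := 𝟙 p ⊗ₘ 𝟙 q) (φ' := 𝟙 (p ⊗ q)) (Iso.refl _) (Iso.refl _) (by simp)
    (ψ := 𝟙 r) (ψ' := 𝟙 r) (Iso.refl _) (Iso.refl _) (by simp)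
  have e₂ := ncMu_equiv (φ := 𝟙 p) (φ' := 𝟙 p) (Iso.refl _) (Iso.refl _) (by simp)
    (ψ := 𝟙 q ⊗ₘ 𝟙 r) (ψ' := 𝟙 (q ⊗ r)) (Iso.refl _) (Iso.refl _) (by simp)
  rw [ncIso_refl, tensorHom_id _ (ncLetter (𝟙 r))] at e₁
  rw [ncIso_refl (𝟙 p), id_tensorHom (ncLetter (𝟙 p))] at e₂
  have h : (ncMu (𝟙 p) (𝟙 q) ≫
        ncIso (ψ := 𝟙 (p ⊗ q)) (Iso.refl _) (Iso.refl _) (by simp)) ▷ ncLetter (𝟙 r) ≫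
      (ncMu (𝟙 (p ⊗ q)) (𝟙 r) ≫
        ncIso (ψ := 𝟙 ((p ⊗ q) ⊗ r)) (Iso.refl _) (Iso.refl _) (by simp)) ≫
      ncIso (φ := 𝟙 ((p ⊗ q) ⊗ r)) (ψ := 𝟙 (p ⊗ (q ⊗ r))) (α_ p q r) (α_ p q r) (by simp) =
      (α_ (ncLetter (𝟙 p)) (ncLetter (𝟙 q)) (ncLetter (𝟙 r))).hom ≫
        ncLetter (𝟙 p) ◁ (ncMu (𝟙 q) (𝟙 r) ≫
          ncIso (ψ := 𝟙 (q ⊗ r)) (Iso.refl _) (Iso.refl _) (by simp)) ≫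
        ncMu (𝟙 p) (𝟙 (q ⊗ r)) ≫
          ncIso (ψ := 𝟙 (p ⊗ (q ⊗ r))) (Iso.refl _) (Iso.refl _) (by simp) := by
    rw [comp_whiskerRight_assoc, Category.assoc, reassoc_of% e₁, whiskerLeft_comp_assoc,
      reassoc_of% e₂, ← reassoc_of% (ncMu_assoc (𝟙 p) (𝟙 q) (𝟙 r))]
    simp only [ncIso_comp]
    congr 2
    exact ncIso_congr (by simp) (by simp)
  exact h

theorem ncμ_left_unit (n : FTriv) :
    ncε ▷ basic n ≫ ncμ (𝟙_ FTriv) n ≫ ncAct (λ_ n).hom = (λ_ (basic n)).hom := by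
  have h : ncEps ▷ ncLetter (𝟙 n) ≫ (ncMu (𝟙 (𝟙_ FTriv)) (𝟙 n) ≫
      ncIso (ψ := 𝟙 (𝟙_ FTriv ⊗ n)) (Iso.refl _) (Iso.refl _) (by simp)) ≫
      ncIso (φ := 𝟙 (𝟙_ FTriv ⊗ n)) (ψ := 𝟙 n) (λ_ n) (λ_ n) (by simp) =
      (λ_ (ncLetter (𝟙 n))).hom := by
    rw [← ncMu_left_unit, Category.assoc, ncIso_comp]
    congr 2
  exact h

theorem ncμ_right_unit (n : FTriv) :
    basic n ◁ ncε ≫ ncμ n (𝟙_ FTriv) ≫ ncAct (ρ_ n).hom = (ρ_ (basic n)).hom := by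
  have h : ncLetter (𝟙 n) ◁ ncEps ≫ (ncMu (𝟙 n) (𝟙 (𝟙_ FTriv)) ≫
      ncIso (ψ := 𝟙 (n ⊗ 𝟙_ FTriv)) (Iso.refl _) (Iso.refl _) (by simp)) ≫
      ncIso (φ := 𝟙 (n ⊗ 𝟙_ FTriv)) (ψ := 𝟙 n) (ρ_ n) (ρ_ n) (by simp) =
      (ρ_ (ncLetter (𝟙 n))).hom := by
    rw [← ncMu_right_unit, Category.assoc, ncIso_comp]
    congr 2
  exact h

theorem ncμ_comm (p q : FTriv) :
    ncμ p q ≫ ncAct (β_ p q).hom = (β_ (basic p) (basic q)).hom ≫ ncμ q p := by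
  have h : (ncMu (𝟙 p) (𝟙 q) ≫
      ncIso (ψ := 𝟙 (p ⊗ q)) (Iso.refl _) (Iso.refl _) (by simp)) ≫
      ncIso (φ := 𝟙 (p ⊗ q)) (ψ := 𝟙 (q ⊗ p)) (β_ p q) (β_ p q) (by simp) =
      (β_ (ncLetter (𝟙 p)) (ncLetter (𝟙 q))).hom ≫ ncMu (𝟙 q) (𝟙 p) ≫
        ncIso (ψ := 𝟙 (q ⊗ p)) (Iso.refl _) (Iso.refl _) (by simp) := by
    rw [← reassoc_of% (ncMu_comm (𝟙 p) (𝟙 q)), Category.assoc, ncIso_comp, ncIso_comp]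
    congr 1
  exact h

instance : basicFunctor.LaxMonoidal where
  ε := ncε
  μ := ncμ
  μ_natural_left σ r := by
    have h := ncμ_act σ (𝟙 r)
    rw [show ncAct (𝟙 r) = 𝟙 (basic r) from basicFunctor.map_id r, tensorHom_id,
      tensorHom_id] at h
    exact h
  μ_natural_right r σ := by
    have h := ncμ_act (𝟙 r) σ
    rw [show ncAct (𝟙 r) = 𝟙 (basic r) from basicFunctor.map_id r, id_tensorHom,
      id_tensorHom] at h
    exact h
  associativity := ncμ_assoc
  left_unitality n := (ncμ_left_unit n).symm
  right_unitality n := (ncμ_right_unit n).symm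

instance : basicFunctor.LaxBraided where
  braided := ncμ_comm

/-- This is the interchange law between `γ` and `μ`; equivariance of both (`e₁`, `e₂`) absorbs the
corrections between `𝟙 p ⊗ₘ 𝟙 q`, `𝟙 p ≫ 𝟙 p` and genuine identities. -/
theorem isMulHom_ncμ (p q : FTriv) :
    IsMulHom (tensorMul (ncγ p) (ncγ q)) (ncγ (p ⊗ q)) (ncμ p q) := by
  have e₁ := ncGamma_equiv (φ₁ := 𝟙 p ⊗ₘ 𝟙 q) (φ₁' := 𝟙 (p ⊗ q)) (φ₀ := 𝟙 p ⊗ₘ 𝟙 q)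
    (φ₀' := 𝟙 (p ⊗ q)) (Iso.refl _) (Iso.refl _) (Iso.refl _) (by simp) (by simp)
  have e₂ := ncMu_equiv (φ := 𝟙 p ≫ 𝟙 p) (φ' := 𝟙 p) (Iso.refl _) (Iso.refl _) (by simp)
    (ψ := 𝟙 q ≫ 𝟙 q) (ψ' := 𝟙 q) (Iso.refl _) (Iso.refl _) (by simp)
  have h : ((ncMu (𝟙 p) (𝟙 q) ≫ ncIso (ψ := 𝟙 (p ⊗ q)) (Iso.refl _) (Iso.refl _) (by simp)) ⊗ₘ
      (ncMu (𝟙 p) (𝟙 q) ≫ ncIso (ψ := 𝟙 (p ⊗ q)) (Iso.refl _) (Iso.refl _) (by simp))) ≫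
      ncGamma (𝟙 (p ⊗ q)) (𝟙 (p ⊗ q)) ≫
        ncIso (ψ := 𝟙 (p ⊗ q)) (Iso.refl _) (Iso.refl _) (by simp) =
      (tensorμ _ _ _ _ ≫
      ((ncGamma (𝟙 p) (𝟙 p) ≫ ncIso (ψ := 𝟙 p) (Iso.refl _) (Iso.refl _) (by simp)) ⊗ₘ
      (ncGamma (𝟙 q) (𝟙 q) ≫ ncIso (ψ := 𝟙 q) (Iso.refl _) (Iso.refl _) (by simp)))) ≫
      ncMu (𝟙 p) (𝟙 q) ≫ ncIso (ψ := 𝟙 (p ⊗ q)) (Iso.refl _) (Iso.refl _) (by simp) := by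
    rw [← tensorHom_comp_tensorHom, ← tensorHom_comp_tensorHom]
    simp only [Category.assoc]
    rw [reassoc_of% e₁, reassoc_of% e₂,
      ← reassoc_of% (nc_interchange (𝟙 p) (𝟙 p) (𝟙 q) (𝟙 q))]
    simp only [ncIso_comp]
    congr 2
    exact ncIso_congr (by simp) (by simp)
  exact h

theorem isMulHom_ncε : IsMulHom (λ_ (𝟙_ (NCPlus FTriv))).hom (ncγ (𝟙_ FTriv)) ncε :=
  nc_interchange_unit

end FTriv

/-! ## Lax braided functors and multiplications -/

section

universe v₁ u₁

variable {D : Type u₁} [Category.{v₁} D] [MonoidalCategory D]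
  {C : Type u} [Category.{v} C] [MonoidalCategory C]

open Functor.LaxMonoidal

/-- The multiplication induced by a lax monoidal functor. -/
def mapMul (Q : D ⥤ C) [Q.LaxMonoidal] {A : D} (a : A ⊗ A ⟶ A) :
    Q.obj A ⊗ Q.obj A ⟶ Q.obj A :=
  μ Q A A ≫ Q.map a

theorem IsMulHom.map (Q : D ⥤ C) [Q.LaxMonoidal] {A B : D} {a : A ⊗ A ⟶ A} {b : B ⊗ B ⟶ B}
    {f : A ⟶ B} (h : IsMulHom a b f) : IsMulHom (mapMul Q a) (mapMul Q b) (Q.map f) := by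
  unfold IsMulHom mapMul at *
  rw [← Category.assoc, μ_natural, Category.assoc, ← Q.map_comp, h, Q.map_comp, Category.assoc]

theorem isMulHom_ε (Q : D ⥤ C) [Q.LaxMonoidal] :
    IsMulHom (λ_ (𝟙_ C)).hom (mapMul Q (λ_ (𝟙_ D)).hom) (ε Q) := by
  unfold IsMulHom mapMul
  rw [MonoidalCategory.tensorHom_def', Category.assoc, ← left_unitality, leftUnitor_naturality]

/-- A lax braided functor carries the middle interchange to the middle interchange, and its
tensorator is natural. -/
theorem isMulHom_μ [SymmetricCategory D] [SymmetricCategory C] (Q : D ⥤ C) [Q.LaxBraided]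
    {A B : D} (a : A ⊗ A ⟶ A) (b : B ⊗ B ⟶ B) :
    IsMulHom (tensorMul (mapMul Q a) (mapMul Q b)) (mapMul Q (tensorMul a b)) (μ Q A B) := by
  unfold IsMulHom mapMul tensorMul
  rw [← tensorHom_comp_tensorHom, Category.assoc, Category.assoc, μ_natural, Q.map_comp,
    tensorμ_comp_μ_tensorHom_μ_comp_μ_assoc]

end

/-! ## Braided functors out of the trivial Feynman category -/

/-- The bijection that moves the last position to `i` and keeps the order of the others. -/
def insertEquiv {n : ℕ} (i : Fin (n + 1)) : Fin (n + 1) ≃ Fin (n + 1) :=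
  (finSuccEquiv' (Fin.last n)).trans (finSuccEquiv' i).symm

@[simp]
theorem insertEquiv_last {n : ℕ} (i : Fin (n + 1)) : insertEquiv i (Fin.last n) = i := by
  simp [insertEquiv]

@[simp]
theorem insertEquiv_castSucc {n : ℕ} (i : Fin (n + 1)) (j : Fin n) :
    insertEquiv i j.castSucc = i.succAbove j := by
  rw [insertEquiv, Equiv.trans_apply, ← Fin.succAbove_last_apply, finSuccEquiv'_succAbove,
    finSuccEquiv'_symm_some]

theorem insertEquiv_val {n : ℕ} (i j : Fin (n + 1)) :
    (insertEquiv i j : ℕ) = if (j : ℕ) = n then (i : ℕ) else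
      if (j : ℕ) < i then (j : ℕ) else j + 1 := by
  induction j using Fin.lastCases with
  | last => simp
  | cast j => simp [val_succAbove, j.2.ne]

/-- The recursion defining `permMap`, now inside the symmetric groups: it lets a functor on `FTriv`
be evaluated along the same steps. -/
theorem sumMap_dropLast_trans_insertEquiv {n m : ℕ} (σ : Fin (n + 1) ≃ Fin (m + 1)) :
    (FTriv.sumMap (dropLast σ) (Equiv.refl (Fin 1))).trans (insertEquiv (σ (Fin.last n))) = σ := by
  ext j : 1
  induction j using Fin.lastCases with
  | last =>
    exact (congrArg _ (sumMap_last (dropLast σ) (Equiv.refl (Fin 1)))).trans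
      (insertEquiv_last (σ (Fin.last n)))
  | cast j =>
    refine (congrArg (insertEquiv (σ (Fin.last n)))
      (FTriv.sumMap_castAdd (dropLast σ) (Equiv.refl (Fin 1)) j)).trans ?_
    exact (insertEquiv_castSucc _ _).trans (succAbove_dropLast σ j)

theorem insertEquiv_last_eq (n : ℕ) : insertEquiv (Fin.last n) = Equiv.refl (Fin (n + 1)) := by
  ext j
  simp only [insertEquiv_val, Fin.val_last, Equiv.refl_apply]
  split_ifs <;> omega

/-- Counterpart of `insertLast_castSucc` for bijections: a non-final insertion is one transposition
followed by an insertion among fewer points. -/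
theorem swapLast_comp_insertEquiv (n : ℕ) (i : Fin (n + 1)) :
    swapLast (⟨n⟩ : FTriv) ⟨1⟩ ⟨1⟩ ≫ FTriv.sumMap (insertEquiv i) (Equiv.refl (Fin 1)) =
      insertEquiv i.castSucc := by
  have h : (FTriv.sumMap (Equiv.refl (Fin n)) (finAddFlip (m := 1) (n := 1))).trans
      (@FTriv.sumMap (n + 1) (n + 1) 1 1 (insertEquiv i) (Equiv.refl (Fin 1))) =
      @insertEquiv (n + 1) i.castSucc := by
    ext j
    simp only [Equiv.trans_apply, FTriv.sumMap_val, insertEquiv_val, FTriv.finAddFlip_val,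
      Equiv.refl_apply, Fin.val_castSucc]
    split_ifs <;> omega
  exact h

section

variable {C : Type u} [Category.{v} C] [MonoidalCategory C] [SymmetricCategory C]

open Functor.LaxMonoidal

theorem map_swapLast {D : Type*} [Category* D] [MonoidalCategory D] [SymmetricCategory D]
    (F : D ⥤ C) [F.LaxBraided] (a b c : D) :
    μ F a b ▷ F.obj c ≫ μ F (a ⊗ b) c ≫ F.map (swapLast a b c) =
      swapLast (F.obj a) (F.obj b) (F.obj c) ≫ μ F a c ▷ F.obj b ≫ μ F (a ⊗ c) b := by
  have hβ := Functor.LaxBraided.braided (F := F) b c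
  rw [swapLast, swapLast, F.map_comp, F.map_comp, associativity_assoc, ← μ_natural_right_assoc,
    ← whiskerLeft_comp_assoc, hβ, whiskerLeft_comp_assoc]
  simp only [Category.assoc]
  rw [associativity_inv]

/-! ### Comparison of a strong braided functor with tensor powers. -/

variable (F : FTriv ⥤ C) [F.LaxBraided] [∀ p q, IsIso (μ F p q)] [IsIso (ε F)] {M : C}
  (e : F.obj ⟨1⟩ ≅ M)

/-- The comparison between a braided functor on the trivial Feynman category and tensor powers. -/
noncomputable def compareIso : ∀ n : ℕ, F.obj ⟨n⟩ ≅ tpow M n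
  | 0 => (asIso (ε F)).symm
  | n + 1 => (asIso (μ F ⟨n⟩ ⟨1⟩)).symm ≪≫ (compareIso n ⊗ᵢ e)

theorem ε_compareIso : ε F ≫ (compareIso F e 0).hom = 𝟙 (𝟙_ C) := IsIso.hom_inv_id (ε F)

theorem μ_compareIso_succ (n : ℕ) :
    μ F ⟨n⟩ ⟨1⟩ ≫ (compareIso F e (n + 1)).hom = (compareIso F e n).hom ⊗ₘ e.hom :=
  IsIso.hom_inv_id_assoc (μ F ⟨n⟩ ⟨1⟩) _

theorem compareIso_one : (compareIso F e 1).hom = e.hom ≫ (λ_ M).inv := by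
  have h₁ := μ_compareIso_succ F e 0
  have h₂ : ε F ▷ F.obj ⟨1⟩ ≫ μ F (𝟙_ FTriv) ⟨1⟩ = (λ_ (F.obj ⟨1⟩)).hom := by
    have h := left_unitality F (⟨1⟩ : FTriv)
    -- As `0 + 1` reduces to `1`, this unitor is the identity permutation, and left unitality loses
    -- its cast.
    rw [show F.map (λ_ (⟨1⟩ : FTriv)).hom = 𝟙 (F.obj ⟨1⟩) from F.map_id _] at h
    rw [h]
    exact congrArg _ (Category.comp_id _).symm
  have key : ∀ {I A : C} {i : 𝟙_ C ⟶ I} {j : I ⟶ 𝟙_ C} {e : A ⟶ M} {s : I ⊗ A ⟶ A}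
      {t : A ⟶ 𝟙_ C ⊗ M}
      (_ : s ≫ t = j ⊗ₘ e) (_ : i ▷ A ≫ s = (λ_ A).hom) (_ : i ≫ j = 𝟙 _),
      t = e ≫ (λ_ M).inv := by
    intro I A i j e s t e₁ e₂ e₃
    rw [← cancel_epi (λ_ A).hom, ← e₂, Category.assoc, e₁, ← comp_tensorHom, e₃, e₂]
    simp
  exact key h₁ h₂ (ε_compareIso F e)

/-- Induction on `q`: associativity of `F` with third letter `⟨1⟩` moves one letter from the right
block outside, matching the recursion for `concat`. Since `p + (q + 1)` is `(p + q) + 1` by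
definition, the associator involved is an identity. -/
theorem μ_compareIso (p : ℕ) : ∀ q : ℕ,
    μ F ⟨p⟩ ⟨q⟩ ≫ (compareIso F e (p + q)).hom =
      ((compareIso F e p).hom ⊗ₘ (compareIso F e q).hom) ≫ concat M p q
  | 0 => by
    have h₂ : F.obj ⟨p⟩ ◁ ε F ≫ μ F ⟨p⟩ (𝟙_ FTriv) = (ρ_ (F.obj ⟨p⟩)).hom := by
      have h := right_unitality F (⟨p⟩ : FTriv)
      rw [show F.map (ρ_ (⟨p⟩ : FTriv)).hom = 𝟙 (F.obj ⟨p⟩) from F.map_id _] at h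
      rw [h]
      exact congrArg _ (Category.comp_id _).symm
    have key : ∀ {I A T : C} {i : 𝟙_ C ⟶ I} {j : I ⟶ 𝟙_ C} {s : A ⊗ I ⟶ A} {t : A ⟶ T}
        (_ : IsIso i) (_ : A ◁ i ≫ s = (ρ_ A).hom) (_ : i ≫ j = 𝟙 _),
        s ≫ t = (t ⊗ₘ j) ≫ (ρ_ T).hom := by
      intro I A T i j s t e₁ e₂ e₃
      rw [← cancel_epi (A ◁ i), ← Category.assoc, e₂, ← Category.assoc, ← tensorHom_comp, e₃]
      simp
    exact key inferInstance h₂ (ε_compareIso F e)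
  | q + 1 => by
    have h := associativity F (⟨p⟩ : FTriv) ⟨q⟩ ⟨1⟩
    rw [show F.map (α_ (⟨p⟩ : FTriv) ⟨q⟩ ⟨1⟩).hom = 𝟙 (F.obj ⟨p + q + 1⟩) from F.map_id _] at h
    have key : ∀ {P Q E Q' PQ PQ' X Y Z : C} {s : Q ⊗ E ⟶ Q'} {t : P ⊗ Q' ⟶ PQ'}
        {s' : P ⊗ Q ⟶ PQ} {t' : PQ ⊗ E ⟶ PQ'} {x : P ⟶ X} {y : Q ⟶ Y} {z : PQ ⟶ Z} {e : E ⟶ M}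
        {c : X ⊗ Y ⟶ Z} {y' : Q' ⟶ Y ⊗ M} {z' : PQ' ⟶ Z ⊗ M} (_ : IsIso s)
        (_ : s' ▷ E ≫ t' ≫ 𝟙 PQ' = (α_ P Q E).hom ≫ P ◁ s ≫ t) (_ : s' ≫ z = (x ⊗ₘ y) ≫ c)
        (_ : s ≫ y' = y ⊗ₘ e) (_ : t' ≫ z' = z ⊗ₘ e),
        t ≫ z' = (x ⊗ₘ y') ≫ (α_ X Y M).inv ≫ c ▷ M := by
      intro P Q E Q' PQ PQ' X Y Z s t s' t' x y z e c y' z' hs e₁ e₂ e₃ e₄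
      rw [← cancel_epi (P ◁ s), ← cancel_epi (α_ P Q E).hom, ← Category.assoc (P ◁ s),
        ← Category.assoc, ← e₁, Category.comp_id, Category.assoc, e₄, ← comp_tensorHom, e₂,
        comp_tensorHom_eq_tensorHom_whiskerRight, ← Category.assoc (P ◁ s), ← tensorHom_comp, e₃,
        associator_inv_naturality_assoc]
      simp
    exact key inferInstance h (μ_compareIso p q) (μ_compareIso_succ F e q)
      (μ_compareIso_succ F e (p + q))

/-- Insertions are built from adjacent transpositions. `F` carries these to braidings by
`map_swapLast`, once its invertible tensorators have been cancelled in front. -/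
theorem map_insertEquiv : ∀ (n : ℕ) (i : Fin (n + 1)),
    F.map (X := ⟨n + 1⟩) (Y := ⟨n + 1⟩) (insertEquiv i) ≫ (compareIso F e (n + 1)).hom =
      (compareIso F e (n + 1)).hom ≫ insertLast M n i := by
  intro n i
  induction i using Fin.lastCases with
  | last =>
    rw [insertEquiv_last_eq, insertLast_last,
      show F.map (X := ⟨n + 1⟩) (Y := ⟨n + 1⟩) (Equiv.refl (Fin (n + 1))) = 𝟙 _ from F.map_id _]
    exact (Category.id_comp _).trans (Category.comp_id _).symm
  | cast i =>
    cases n with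
    | zero => exact i.elim0
    | succ n =>
      have hF : F.map (X := ⟨n + 1 + 1⟩) (Y := ⟨n + 1 + 1⟩) (insertEquiv i.castSucc) =
          F.map (swapLast (⟨n⟩ : FTriv) ⟨1⟩ ⟨1⟩) ≫
            F.map ((show (⟨n + 1⟩ : FTriv) ⟶ ⟨n + 1⟩ from insertEquiv i) ▷ (⟨1⟩ : FTriv)) := by
        rw [← F.map_comp]
        exact congrArg _ (swapLast_comp_insertEquiv n i).symm
      have hn := μ_natural_left F (show (⟨n + 1⟩ : FTriv) ⟶ ⟨n + 1⟩ from insertEquiv i) ⟨1⟩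
      rw [hF, insertLast_castSucc]
      have key : ∀ {N E N₁ N₂ X : C} {s : N ⊗ E ⟶ N₁} {t : N₁ ⊗ E ⟶ N₂} {w : N₂ ⟶ N₂}
          {j : N₁ ⟶ N₁} {j' : N₂ ⟶ N₂} {x : N ⟶ X} {e : E ⟶ M} {x₁ : N₁ ⟶ X ⊗ M}
          {x₂ : N₂ ⟶ (X ⊗ M) ⊗ M} {l : X ⊗ M ⟶ X ⊗ M} (_ : IsIso s) (_ : IsIso t)
          (_ : s ▷ E ≫ t ≫ w = swapLast N E E ≫ s ▷ E ≫ t) (_ : j ▷ E ≫ t = t ≫ j')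
          (_ : s ≫ x₁ = x ⊗ₘ e) (_ : t ≫ x₂ = x₁ ⊗ₘ e) (_ : j ≫ x₁ = x₁ ≫ l),
          (w ≫ j') ≫ x₂ = x₂ ≫ swapLast X M M ≫ l ▷ M := by
        intro N E N₁ N₂ X s t w j j' x e x₁ x₂ l hs ht e₁ e₂ e₃ e₄ e₅
        have e₆ : s ▷ E ≫ t ≫ x₂ = (x ⊗ₘ e) ⊗ₘ e := by rw [e₄, ← comp_tensorHom, e₃]
        rw [← cancel_epi t, ← cancel_epi (s ▷ E)]
        calc _ = (s ▷ E ≫ t ≫ w) ≫ j' ≫ x₂ := by simp only [Category.assoc]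
          _ = swapLast N E E ≫ s ▷ E ≫ (t ≫ j') ≫ x₂ := by rw [e₁]; simp only [Category.assoc]
          _ = swapLast N E E ≫ s ▷ E ≫ j ▷ E ≫ (t ≫ x₂) := by
            rw [← e₂]; simp only [Category.assoc]
          _ = swapLast N E E ≫ ((x ⊗ₘ e) ⊗ₘ e) ≫ l ▷ M := by
            rw [e₄, ← comp_tensorHom, e₅, comp_tensorHom_eq_tensorHom_whiskerRight,
              ← Category.assoc (s ▷ E), ← comp_tensorHom, e₃]
          _ = ((x ⊗ₘ e) ⊗ₘ e) ≫ swapLast X M M ≫ l ▷ M := by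
            rw [← Category.assoc, ← swapLast_naturality, Category.assoc]
          _ = _ := by rw [← e₆]; simp only [Category.assoc]
      exact key inferInstance inferInstance (map_swapLast F ⟨n⟩ ⟨1⟩ ⟨1⟩) hn
        (μ_compareIso_succ F e n) (μ_compareIso_succ F e (n + 1)) (map_insertEquiv n i)

theorem map_compareIso : ∀ {n k : ℕ} (σ : Fin n ≃ Fin k),
    F.map (X := ⟨n⟩) (Y := ⟨k⟩) σ ≫ (compareIso F e k).hom =
      (compareIso F e n).hom ≫ permMap M σ
  | 0, 0, σ => by
    obtain rfl : σ = Equiv.refl (Fin 0) := Subsingleton.elim _ _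
    rw [permMap_refl,
      show F.map (X := ⟨0⟩) (Y := ⟨0⟩) (Equiv.refl (Fin 0)) = 𝟙 _ from F.map_id _]
    exact (Category.id_comp _).trans (Category.comp_id _).symm
  | 0, _ + 1, σ => (σ.symm 0).elim0
  | _ + 1, 0, σ => (σ 0).elim0
  | n + 1, k + 1, σ => by
    have hF : F.map (X := ⟨n + 1⟩) (Y := ⟨k + 1⟩) σ =
        F.map ((show (⟨n⟩ : FTriv) ⟶ ⟨k⟩ from dropLast σ) ▷ (⟨1⟩ : FTriv)) ≫
          F.map (X := ⟨k + 1⟩) (Y := ⟨k + 1⟩) (insertEquiv (σ (Fin.last n))) := by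
      refine Eq.trans ?_ (F.map_comp _ _)
      exact congrArg (F.map (X := ⟨n + 1⟩) (Y := ⟨k + 1⟩))
        (sumMap_dropLast_trans_insertEquiv σ).symm
    have hn := μ_natural_left F (show (⟨n⟩ : FTriv) ⟶ ⟨k⟩ from dropLast σ) ⟨1⟩
    have key : ∀ {N E N₁ K K₁ X Y : C} {s : N ⊗ E ⟶ N₁} {t : K ⊗ E ⟶ K₁} {d : N ⟶ K}
        {d' : N₁ ⟶ K₁} {i : K₁ ⟶ K₁} {x : N ⟶ X} {y : K ⟶ Y} {e : E ⟶ M} {x₁ : N₁ ⟶ X ⊗ M}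
        {y₁ : K₁ ⟶ Y ⊗ M} {p : X ⟶ Y} {l : Y ⊗ M ⟶ Y ⊗ M} (_ : IsIso s)
        (_ : d ▷ E ≫ t = s ≫ d') (_ : s ≫ x₁ = x ⊗ₘ e) (_ : t ≫ y₁ = y ⊗ₘ e)
        (_ : d ≫ y = x ≫ p) (_ : i ≫ y₁ = y₁ ≫ l),
        (d' ≫ i) ≫ y₁ = x₁ ≫ p ▷ M ≫ l := by
      intro N E N₁ K K₁ X Y s t d d' i x y e x₁ y₁ p l hs e₁ e₂ e₃ e₄ e₅
      rw [← cancel_epi s, Category.assoc, e₅, ← Category.assoc s d', ← e₁, Category.assoc,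
        ← Category.assoc t, e₃, ← Category.assoc (d ▷ E), ← comp_tensorHom, e₄,
        comp_tensorHom_eq_tensorHom_whiskerRight, ← e₂]
      simp only [Category.assoc]
    rw [hF, permMap_succ]
    exact key inferInstance hn (μ_compareIso_succ F e n) (μ_compareIso_succ F e k)
      (map_compareIso (dropLast σ)) (map_insertEquiv F e k _)

/-- The comparison is composed of inverses of `ε F` and `μ F` and tensor products with `e`, all
multiplicative by hypothesis. -/
theorem isMulHom_compareIso {m : M ⊗ M ⟶ M} (γ : ∀ n : FTriv, F.obj n ⊗ F.obj n ⟶ F.obj n)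
    (hμ : ∀ p q, IsMulHom (tensorMul (γ p) (γ q)) (γ (p ⊗ q)) (μ F p q))
    (hε : IsMulHom (λ_ (𝟙_ C)).hom (γ (𝟙_ FTriv)) (ε F)) (he : IsMulHom (γ ⟨1⟩) m e.hom) :
    ∀ n : ℕ, IsMulHom (γ ⟨n⟩) (shuffleMul M m n) (compareIso F e n).hom
  | 0 => by
    rw [shuffleMul_zero]
    exact IsMulHom.inv (f := asIso (ε F)) hε
  | n + 1 => by
    rw [shuffleMul_succ]
    exact (IsMulHom.inv (f := asIso (μ F ⟨n⟩ ⟨1⟩)) (hμ ⟨n⟩ ⟨1⟩)).comp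
      ((isMulHom_compareIso γ hμ hε he n).tensor he)

end

/-! ## The pullback of an op along the quotient functor -/

section

variable {C : Type u} [Category.{v} C] [MonoidalCategory C] [SymmetricCategory C]

open Functor.LaxMonoidal FTriv

variable (P : Plus FTriv ⥤ C) [P.Braided]

/-- The only part not invertible already is the image of the generator `μ`, and this is inverted in
the plus construction. -/
instance isIso_μ_basicFunctor (p q : FTriv) :
    IsIso (μ (basicFunctor ⋙ (plusQuotient FTriv ⋙ P)) p q) := by
  have h₀ : IsIso ((plusQuotient FTriv).map (ncMu (𝟙 p) (𝟙 q) ≫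
      ncIso (ψ := 𝟙 (p ⊗ q)) (Iso.refl _) (Iso.refl _) (by simp))) := by
    rw [Functor.map_comp]
    infer_instance
  have h : IsIso ((plusQuotient FTriv).map (ncμ p q)) := h₀
  have h' : IsIso (P.map ((plusQuotient FTriv).map (ncμ p q))) := inferInstance
  have h'' : IsIso ((plusQuotient FTriv ⋙ P).map (ncμ p q)) := h'
  rw [Functor.LaxMonoidal.comp_μ]
  exact (inferInstance : IsIso (μ (plusQuotient FTriv ⋙ P) (basic p) (basic q) ≫
    (plusQuotient FTriv ⋙ P).map (ncμ p q)))

instance isIso_ε_basicFunctor : IsIso (ε (basicFunctor ⋙ (plusQuotient FTriv ⋙ P))) := by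
  have h : IsIso ((plusQuotient FTriv).map ncε) := isIso_plusQuotient_ncEps
  have h' : IsIso (P.map ((plusQuotient FTriv).map ncε)) := inferInstance
  have h'' : IsIso ((plusQuotient FTriv ⋙ P).map ncε) := h'
  rw [Functor.LaxMonoidal.comp_ε]
  exact (inferInstance : IsIso (ε (plusQuotient FTriv ⋙ P) ≫ (plusQuotient FTriv ⋙ P).map ncε))

theorem mapMul_ncγ_one {M : C} {m : M ⊗ M ⟶ M} {e : P.obj star ≅ M}
    (he : μ P star star ≫ P.map starMul ≫ e.hom = (e.hom ⊗ₘ e.hom) ≫ m) :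
    IsMulHom (mapMul (plusQuotient FTriv ⋙ P) (ncγ ⟨1⟩)) m e.hom := by
  -- The quotient functor is the identity on words and has identity structure maps.
  have hμ : μ (plusQuotient FTriv ⋙ P) (basic ⟨1⟩) (basic ⟨1⟩) = μ P star star := by
    rw [Functor.LaxMonoidal.comp_μ]
    refine (congrArg _ (P.map_id _)).trans ?_
    exact Category.comp_id _
  unfold IsMulHom mapMul
  rw [hμ]
  exact he.symm.trans (Category.assoc _ _ _).symm

theorem exists_compare {M : C} {m : M ⊗ M ⟶ M} (e : P.obj star ≅ M)
    (he : μ P star star ≫ P.map starMul ≫ e.hom = (e.hom ⊗ₘ e.hom) ≫ m) :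
    ∃ θ : ∀ n : FTriv, (plusQuotient FTriv ⋙ P).obj (basic n) ≅ tpow M n.len,
      (θ ⟨1⟩).hom = e.hom ≫ (λ_ M).inv ∧
      (∀ (n k : FTriv) (σ : Fin n.len ≃ Fin k.len),
        (plusQuotient FTriv ⋙ P).map (ncAct σ) ≫ (θ k).hom = (θ n).hom ≫ permMap M σ) ∧
      (∀ n : FTriv, μ (plusQuotient FTriv ⋙ P) (basic n) (basic n) ≫
          (plusQuotient FTriv ⋙ P).map (ncγ n) ≫ (θ n).hom =
        ((θ n).hom ⊗ₘ (θ n).hom) ≫ shuffleMul M m n.len) ∧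
      (∀ p q : FTriv, μ (plusQuotient FTriv ⋙ P) (basic p) (basic q) ≫
          (plusQuotient FTriv ⋙ P).map (ncμ p q) ≫ (θ (p ⊗ q)).hom =
        ((θ p).hom ⊗ₘ (θ q).hom) ≫ concat M p.len q.len) ∧
      ε (plusQuotient FTriv ⋙ P) ≫ (plusQuotient FTriv ⋙ P).map ncε ≫ (θ (𝟙_ FTriv)).hom =
        𝟙 (𝟙_ C) := by
  let Q := plusQuotient FTriv ⋙ P
  let F := basicFunctor ⋙ Q
  refine ⟨fun n => compareIso F e n.len, compareIso_one F e, fun n k σ => map_compareIso F e σ,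
    fun n => ?_, fun p q => ?_, ?_⟩
  · have h := isMulHom_compareIso F e (m := m) (fun n => mapMul Q (ncγ n))
      (fun p q => (isMulHom_μ Q (ncγ p) (ncγ q)).comp ((isMulHom_ncμ p q).map Q))
      ((isMulHom_ε Q).comp (isMulHom_ncε.map Q)) (mapMul_ncγ_one P he) n.len
    exact (h.trans (Category.assoc _ _ _)).symm
  · exact (Category.assoc _ _ _).symm.trans (μ_compareIso F e p.len q.len)
  · exact (Category.assoc _ _ _).symm.trans (ε_compareIso F e)

end

/-- An op is a strong symmetric monoidal functor; a monoid `(M, m)` corresponds to an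
`(F^triv)^+`-op `P` through an isomorphism `e : P(id_∗) ≅ M` carrying `P(γ)` to `m`. -/
theorem mainTheorem5 {C : Type u} [Category.{v} C] [MonoidalCategory C] [SymmetricCategory C]
    (M : C) (m : M ⊗ M ⟶ M) (hm : m ▷ M ≫ m = (α_ M M M).hom ≫ M ◁ m ≫ m) :
    -- the monoid is an `(F^triv)^+`-op
    (∃ (P : Plus FTriv ⥤ C) (_ : P.Braided) (e : P.obj FTriv.star ≅ M),
      Functor.LaxMonoidal.μ P FTriv.star FTriv.star ≫ P.map FTriv.starMul ≫ e.hom =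
        (e.hom ⊗ₘ e.hom) ≫ m) ∧
    -- its pullback along the quotient functor, an `(F^triv)^{nc+}`-op, is `M^{⊗ n}` with the
    -- permutation action, the shuffled componentwise multiplication and concatenation
    (∀ (P : Plus FTriv ⥤ C) [P.Braided] (e : P.obj FTriv.star ≅ M),
      Functor.LaxMonoidal.μ P FTriv.star FTriv.star ≫ P.map FTriv.starMul ≫ e.hom =
        (e.hom ⊗ₘ e.hom) ≫ m →
      ∃ θ : ∀ n : FTriv, (plusQuotient FTriv ⋙ P).obj (FTriv.basic n) ≅ tpow M n.len,
        (θ ⟨1⟩).hom = e.hom ≫ (λ_ M).inv ∧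
        (∀ (n k : FTriv) (σ : Fin n.len ≃ Fin k.len),
          (plusQuotient FTriv ⋙ P).map (FTriv.ncAct σ) ≫ (θ k).hom =
            (θ n).hom ≫ permMap M σ) ∧
        (∀ n : FTriv,
          Functor.LaxMonoidal.μ (plusQuotient FTriv ⋙ P) (FTriv.basic n) (FTriv.basic n) ≫
              (plusQuotient FTriv ⋙ P).map (FTriv.ncγ n) ≫ (θ n).hom =
            ((θ n).hom ⊗ₘ (θ n).hom) ≫ shuffleMul M m n.len) ∧
        (∀ p q : FTriv,
          Functor.LaxMonoidal.μ (plusQuotient FTriv ⋙ P) (FTriv.basic p) (FTriv.basic q) ≫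
              (plusQuotient FTriv ⋙ P).map (FTriv.ncμ p q) ≫ (θ (p ⊗ q)).hom =
            ((θ p).hom ⊗ₘ (θ q).hom) ≫ concat M p.len q.len) ∧
        Functor.LaxMonoidal.ε (plusQuotient FTriv ⋙ P) ≫
            (plusQuotient FTriv ⋙ P).map FTriv.ncε ≫ (θ (𝟙_ FTriv)).hom = 𝟙 (𝟙_ C)) ∧
    -- this is a monoid object in symmetric sequences of monoids
    IsSymSeqMonoid (fun n : FTriv => tpow M n.len) (fun σ => permMap M σ)
      (fun n => shuffleMul M m n.len) (fun p q => concat M p.len q.len) (𝟙 (𝟙_ C)) ∧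
    -- and if `M` has a unit, then all the monoids and morphisms involved are unital
    (∀ u : 𝟙_ C ⟶ M, u ▷ M ≫ m = (λ_ M).hom → M ◁ u ≫ m = (ρ_ M).hom →
      IsUnitalSymSeqMonoid (fun n : FTriv => tpow M n.len) (fun σ => permMap M σ)
        (fun n => shuffleMul M m n.len) (fun p q => concat M p.len q.len) (𝟙 (𝟙_ C))
        (fun n => unitPow M u n.len)) := by
  refine ⟨exists_op hm, ?_, isSymSeqMonoid_tpow m hm,
    fun u hl hr => isUnitalSymSeqMonoid_tpow m u hm hl hr⟩
  intro P _ e he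
  exact exists_compare P e he
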